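/- Let $V$ be a finite-dimensional real Euclidean space. For $0\ne\alpha\in V$ let $s_\alpha$ be the orthogonal reflection in the hyperplane $\alpha^\perp$. Let $\Phi\subseteq V\setminus\{0\}$ be a finite set such that $s_\alpha(\beta)\in\Phi$ for all $\alpha,\beta\in\Phi$, and such that $\alpha,c\alpha\in\Phi$ with $c\in\mathbb R$ implies $c=\pm1$ (a root system, not necessarily crystallographic and not necessarily spanning $V$). Let $\Pi\subseteq\Phi$ be a simple system, i.e. a linearly independent subset such that, with $\Phi_+:=\Phi\cap\mathbb R_{\ge0}\Pi$, $\Phi$ is the disjoint union of $\Phi_+$ and $-\Phi_+$. Let $W$ be the (finite) group generated by the reflections $s_\alpha$ $(\alpha\in\Phi)$, let $S:=\{s_\alpha\mid\alpha\in\Pi\}$, and for $I\subseteq S$ let $W_I$ be the subgroup of $W$ generated by $I$. For $n\in\mathbb N$ (including $n=0$) let $\mathcal I^{(n)}$ be the set of all sequences $(I_0,I_1,\dots,I_n)$ of subsets of $S$ with $S=I_0\supseteq I_1\supseteq\dots\supseteq I_n$, and let $W$ act diagonally on $V^n$. Then for every $n$ and every $w\in W$, $$\det\nolimits_{V^n}(w)=\det\nolimits_V(w)^n=\sum_{(I_0,\dots,I_n)\in\mathcal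 I^{(n)}}(-1)^{|I_1|+\dots+|I_n|}\,\operatorname{Ind}_{W_{I_n}}^W(1)(w),$$ where $\operatorname{Ind}_{W_{I_n}}^W(1)$ is the character of the real representation of $W$ induced from the trivial representation of $W_{I_n}$. -/

import Mathlib

namespace EuclideanRoots

open scoped NNReal Pointwise

noncomputable section

/-- The orthogonal reflection `s_α` of `V` in the hyperplane orthogonal to `α`. -/
def rootReflection {V : Type*} [NormedAddCommGroup V] [InnerProductSpace ℝ V] (α : V) :
    V ≃ₗ[ℝ] V :=
  ((Submodule.span ℝ {α})ᗮ.reflection).toLinearEquiv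

/-- The usual formula `s_α(v) = v - ⟨v, α^∨⟩ α` with `α^∨ = (2 / ⟨α, α⟩) α`. -/
theorem rootReflection_apply {V : Type*} [NormedAddCommGroup V] [InnerProductSpace ℝ V]
    (α v : V) :
    rootReflection α v = v - inner ℝ v ((2 / inner ℝ α α : ℝ) • α) • α := by
  have h := Submodule.reflection_orthogonal_apply (K := Submodule.span ℝ {α}) v
  change (Submodule.span ℝ {α})ᗮ.reflection v = _
  rw [h, Submodule.reflection_apply, Submodule.starProjection_singleton, inner_smul_right,
    real_inner_self_eq_norm_sq, real_inner_comm v α]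
  simp only [RCLike.ofReal_real_eq_id, id, neg_sub, ← Nat.cast_smul_eq_nsmul ℝ, smul_smul]
  congr 2
  push_cast
  ring

/-- A (finite, reduced, not necessarily crystallographic and not necessarily spanning) root system
in a Euclidean space. -/
structure IsRootSystem {V : Type*} [NormedAddCommGroup V] [InnerProductSpace ℝ V]
    (Φ : Finset V) : Prop where
  zero_notMem : (0 : V) ∉ Φ
  reflection_mem : ∀ α ∈ Φ, ∀ β ∈ Φ, rootReflection α β ∈ Φ
  reduced : ∀ α ∈ Φ, ∀ c : ℝ, c • α ∈ Φ → c = 1 ∨ c = -1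

/-- `Φ₊ = Φ ∩ ℝ_{≥ 0} Δ`. -/
def positiveRoots {V : Type*} [NormedAddCommGroup V] [InnerProductSpace ℝ V]
    (Φ Δ : Finset V) : Set V :=
  (Φ : Set V) ∩ (Submodule.span ℝ≥0 (Δ : Set V) : Set V)

/-- `Δ` is a simple system of `Φ`: a linearly independent subset of `Φ` such that `Φ` is the
disjoint union of `Φ₊ = Φ ∩ ℝ_{≥ 0} Δ` and `-Φ₊`. -/
structure IsSimpleSystem {V : Type*} [NormedAddCommGroup V] [InnerProductSpace ℝ V]
    (Φ Δ : Finset V) : Prop where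
  subset : Δ ⊆ Φ
  linearIndepOn : LinearIndepOn ℝ id (Δ : Set V)
  eq_union : (Φ : Set V) = positiveRoots Φ Δ ∪ -positiveRoots Φ Δ
  disjoint : Disjoint (positiveRoots Φ Δ) (-positiveRoots Φ Δ)

/-- The reflection group `W` of `Φ`, generated by the reflections in the elements of `Φ`. -/
def reflectionGroup {V : Type*} [NormedAddCommGroup V] [InnerProductSpace ℝ V]
    (Φ : Finset V) : Subgroup (V ≃ₗ[ℝ] V) :=
  Subgroup.closure (rootReflection '' (Φ : Set V))

open Classical in
/-- The set `S` of simple reflections `s_α`, `α ∈ Δ`, as a set of elements of `W`. -/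
def simpleReflections {V : Type*} [NormedAddCommGroup V] [InnerProductSpace ℝ V]
    (Φ Δ : Finset V) : Finset (reflectionGroup Φ) :=
  (Δ.image rootReflection).subtype (· ∈ reflectionGroup Φ)

theorem mem_simpleReflections {V : Type*} [NormedAddCommGroup V] [InnerProductSpace ℝ V]
    {Φ Δ : Finset V} {w : reflectionGroup Φ} :
    w ∈ simpleReflections Φ Δ ↔ ∃ α ∈ Δ, rootReflection α = (w : V ≃ₗ[ℝ] V) := by
  simp [simpleReflections]

/-- The standard parabolic subgroup `W_I`, generated by a set `I` of elements of `W`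
(used for `I ⊆ S`). -/
def parabolic {V : Type*} [NormedAddCommGroup V] [InnerProductSpace ℝ V]
    {Φ : Finset V} (I : Finset (reflectionGroup Φ)) : Subgroup (reflectionGroup Φ) :=
  Subgroup.closure (I : Set (reflectionGroup Φ))

open Classical in
/-- The set `𝓘⁽ⁿ⁾` of weakly decreasing sequences `S = I₀ ⊇ I₁ ⊇ ⋯ ⊇ Iₙ` of subsets of `S`. -/
def chains {V : Type*} [NormedAddCommGroup V] [InnerProductSpace ℝ V]
    (Φ Δ : Finset V) (n : ℕ) : Finset (Fin (n + 1) → Finset (reflectionGroup Φ)) :=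
  (Fintype.piFinset fun _ => (simpleReflections Φ Δ).powerset).filter
    fun I => I 0 = simpleReflections Φ Δ ∧ Antitone I

theorem mem_chains {V : Type*} [NormedAddCommGroup V] [InnerProductSpace ℝ V]
    {Φ Δ : Finset V} {n : ℕ} {I : Fin (n + 1) → Finset (reflectionGroup Φ)} :
    I ∈ chains Φ Δ n ↔ I 0 = simpleReflections Φ Δ ∧ Antitone I := by
  simp only [chains, Finset.mem_filter, Fintype.mem_piFinset, Finset.mem_powerset,
    and_iff_right_iff_imp]
  rintro ⟨h0, hI⟩ i
  exact h0 ▸ hI (Fin.zero_le i)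

/-- The character of `Ind_H^G(1)`, the (real) representation of `G` induced from the trivial
one-dimensional representation of the subgroup `H`. -/
def inducedTrivialCharacter {G : Type*} [Group G] (H : Subgroup G) (g : G) : ℝ :=
  (Representation.ind H.subtype (Representation.trivial ℝ H ℝ)).character g

end

end EuclideanRoots

namespace EuclideanRoots

open scoped NNReal

noncomputable section

/-! Write W_K for the subgroup generated by the reflections in a set K of simple roots
(`reflectionGroup K`). The core is Solomon's formula, `IsSimpleSystem.sum_cosetCharacter_eq_det`:
det(w) is the sum over K ⊆ Δ of (-1)^|K| times the number of cosets of W_K fixed by w. To see it,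
let U be the fixed space of w. A fixed coset gW_K corresponds to the face gC_K of the Coxeter
arrangement, where C_K is the face of the chamber on which exactly the simple roots in K vanish.
Such a face is fixed pointwise by w, so these faces are exactly the cells cut out on U by the root
hyperplanes, and gC_K has dimension dim V - |K|. The Euler relation `sum_cells_neg_one_pow_finrank`
on U turns the alternating sum into (-1)^(dim V + dim U), which is det(w) because w is orthogonal
(`det_eq_neg_one_pow`).

Solomon's formula also holds for each W_J, as J is a simple system of Φ ∩ span J. Inducing to W
gives ∑_{K ⊆ J} (-1)^|K| Ind_{W_K}^W(1) = det · Ind_{W_J}^W(1) (`sum_cosetCharacter`). Summing over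
a decreasing sequence one term at a time (`sum_decreasing_sequences`) then produces one factor det
per step, and Ind_W^W(1) = 1 remains. -/

/-! ### Induced trivial characters as fixed-point counts on cosets. -/

open Representation in
theorem indV_mk_mul {G : Type*} [Group G] (H : Subgroup G) (h : H) (x : G) (a : ℝ) :
    IndV.mk H.subtype (Representation.trivial ℝ H ℝ) (h * x) a =
      IndV.mk H.subtype (Representation.trivial ℝ H ℝ) x a := by
  have := Coinvariants.mk_self_apply
    (Representation.tprod ((leftRegular ℝ G).comp H.subtype) (Representation.trivial ℝ H ℝ)) h
    (TensorProduct.tmul ℝ (MonoidAlgebra.single x 1) a)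
  simpa using this

open Representation in
/-- The space of `Ind_H^G(1)` is the space of finitely supported functions on `G ⧸ H`. -/
def indTrivialEquiv {G : Type*} [Group G] (H : Subgroup G) :
    IndV H.subtype (Representation.trivial ℝ H ℝ) ≃ₗ[ℝ] (G ⧸ H →₀ ℝ) :=
  LinearEquiv.ofLinearMap
    (Coinvariants.lift _
      (TensorProduct.lift
        ((Finsupp.lsum ℝ fun x : G => LinearMap.toSpanSingleton ℝ (ℝ →ₗ[ℝ] (G ⧸ H →₀ ℝ))
          -- The coinvariants identify `h * x` with `x`; inversion turns these right cosets into the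
          -- left cosets of `G ⧸ H`.
          (Finsupp.lsingle ((x⁻¹ : G) : G ⧸ H))) ∘ₗ
            (MonoidAlgebra.coeffLinearEquiv ℝ).toLinearMap))
      (by
        intro h
        ext x
        simp))
    (Finsupp.lsum ℝ fun q : G ⧸ H => IndV.mk H.subtype (Representation.trivial ℝ H ℝ) (q.out)⁻¹)
    (by
      ext q
      simp)
    (by
      ext x
      obtain ⟨h, hh⟩ := QuotientGroup.mk_out_eq_mul H x⁻¹
      have := indV_mk_mul H h⁻¹ x 1
      simpa [hh] using this)

open Representation in
theorem indTrivialEquiv_mk {G : Type*} [Group G] (H : Subgroup G) (x : G) (a : ℝ) :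
    indTrivialEquiv H (IndV.mk H.subtype (Representation.trivial ℝ H ℝ) x a) =
      Finsupp.single ((x⁻¹ : G) : G ⧸ H) a := by
  simp [indTrivialEquiv]

open Representation in
theorem indTrivialEquiv_ind_symm {G : Type*} [Group G] (H : Subgroup G) (g : G) (q : G ⧸ H) :
    indTrivialEquiv H (Representation.ind H.subtype (Representation.trivial ℝ H ℝ) g
      ((indTrivialEquiv H).symm (Finsupp.single q 1))) = Finsupp.single (g • q) 1 := by
  have : (indTrivialEquiv H).symm (Finsupp.single q 1) =
      IndV.mk H.subtype (Representation.trivial ℝ H ℝ) (q.out)⁻¹ 1 := by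
    rw [LinearEquiv.symm_apply_eq, indTrivialEquiv_mk, inv_inv, QuotientGroup.out_eq']
  rw [this, ind_mk, indTrivialEquiv_mk]
  rw [mul_inv_rev, inv_inv, inv_inv, ← smul_eq_mul, ← MulAction.Quotient.smul_coe,
    QuotientGroup.out_eq']

/-- The character of `Ind_H^G(1)` counts the fixed points on `G ⧸ H`. -/
theorem inducedTrivialCharacter_eq_card_fixedBy {G : Type*} [Group G] [Finite G]
    (H : Subgroup G) (g : G) :
    inducedTrivialCharacter H g = Nat.card (MulAction.fixedBy (G ⧸ H) g) := by
  classical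
  have := Fintype.ofFinite (G ⧸ H)
  rw [inducedTrivialCharacter, Representation.character,
    LinearMap.trace_eq_matrix_trace ℝ (Module.Basis.ofRepr (indTrivialEquiv H)), Matrix.trace]
  simp only [Matrix.diag_apply, LinearMap.toMatrix_apply, Module.Basis.coe_ofRepr]
  simp only [indTrivialEquiv_ind_symm, Finsupp.single_apply]
  rw [Finset.sum_boole, Nat.card_eq_fintype_card, Fintype.card_subtype]
  rfl

/-- The number of fixed points of `w` on `A ⧸ B` for subgroups `B ≤ A` of a group, expressed
through elements of `A`. -/
def cosetCharacter {G : Type*} [Group G] (A B : Subgroup G) (w : G) : ℝ :=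
  (Nat.card {x : G // x ∈ A ∧ x⁻¹ * w * x ∈ B} : ℝ) / Nat.card B

/-- A coset xH is fixed by g iff x⁻¹gx ∈ H, and it has |H| representatives; hence the division in
`cosetCharacter`. -/
theorem card_fixedBy_mul_card {G : Type*} [Group G] (H : Subgroup G) (g : G) :
    Nat.card {x : G // x⁻¹ * g * x ∈ H} = Nat.card H * Nat.card (MulAction.fixedBy (G ⧸ H) g) := by
  rw [← Nat.card_prod, ← Nat.card_congr (QuotientGroup.preimageMkEquivSubgroupProdSet H _)]
  refine Nat.card_congr (Equiv.subtypeEquivRight fun x => ?_)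
  rw [Set.mem_preimage, MulAction.mem_fixedBy, MulAction.Quotient.smul_coe, eq_comm,
    QuotientGroup.eq, smul_eq_mul, mul_assoc]

theorem card_fixedBy_eq_cosetCharacter {G : Type*} [Group G] (A B : Subgroup G) [Finite A]
    (hBA : B ≤ A) (w : A) :
    (Nat.card (MulAction.fixedBy (A ⧸ B.subgroupOf A) w) : ℝ) = cosetCharacter A B w := by
  have h1 := card_fixedBy_mul_card (B.subgroupOf A) w
  have h2 : Nat.card (B.subgroupOf A) = Nat.card B :=
    Nat.card_congr (Subgroup.subgroupOfEquivOfLe hBA).toEquiv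
  have : Finite B := Finite.of_injective _ (Subgroup.inclusion_injective hBA)
  have h3 : Nat.card {x : A // x⁻¹ * w * x ∈ B.subgroupOf A} =
      Nat.card {x : G // x ∈ A ∧ x⁻¹ * w * x ∈ B} := by
    refine Nat.card_congr ((Equiv.subtypeSubtypeEquivSubtypeInter (· ∈ A)
      (fun x : G => x⁻¹ * w * x ∈ B)).symm.trans ?_).symm
    exact Equiv.subtypeEquivRight fun x => by simp [Subgroup.mem_subgroupOf]
  have h4 : (Nat.card B : ℝ) ≠ 0 := by exact_mod_cast Nat.card_pos.ne'
  rw [cosetCharacter, ← h3, h1, h2, eq_div_iff h4]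
  push_cast
  ring

theorem inducedTrivialCharacter_eq_cosetCharacter {G : Type*} [Group G] {A : Subgroup G} [Finite A]
    (H : Subgroup A) (w : A) :
    inducedTrivialCharacter H w = cosetCharacter A (H.map A.subtype) w := by
  have h := card_fixedBy_eq_cosetCharacter A (H.map A.subtype) (Subgroup.map_subtype_le H) w
  rw [← h, inducedTrivialCharacter_eq_card_fixedBy, Subgroup.subgroupOf,
    Subgroup.comap_map_eq_self_of_injective A.subtype_injective]

theorem cosetCharacter_self {G : Type*} [Group G] {A : Subgroup G} [Finite A] {w : G}
    (hw : w ∈ A) : cosetCharacter A A w = 1 := by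
  have h4 : (Nat.card A : ℝ) ≠ 0 := by exact_mod_cast Nat.card_pos.ne'
  rw [cosetCharacter, div_eq_one_iff_eq h4]
  norm_cast
  refine Nat.card_congr (Equiv.subtypeEquivRight fun x => ?_)
  exact ⟨fun h => h.1, fun h => ⟨h, A.mul_mem (A.mul_mem (A.inv_mem h) hw) h⟩⟩

/-- Transitivity of induction for the characters `cosetCharacter`. -/
theorem card_mul_cosetCharacter {G : Type*} [Group G] {A B C : Subgroup G} [Fintype A]
    (hBA : B ≤ A) (hCB : C ≤ B) [DecidablePred (· ∈ B)] (w : G) :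
    Nat.card B * cosetCharacter A C w =
      ∑ x : A, if (x : G)⁻¹ * w * x ∈ B then cosetCharacter B C ((x : G)⁻¹ * w * x) else 0 := by
  classical
  have : Finite B := Finite.of_injective _ (Subgroup.inclusion_injective hBA)
  have := Fintype.ofFinite B
  -- The bijection is (b, x) ↦ (xb⁻¹, b): conjugating w by xb⁻¹ and then by b is conjugating by x.
  have e : B × {x : G // x ∈ A ∧ x⁻¹ * w * x ∈ C} ≃
      Σ x : A, {y : G // y ∈ B ∧ y⁻¹ * ((x : G)⁻¹ * w * x) * y ∈ C} :=
    { toFun := fun p => ⟨⟨p.2.1 * (p.1 : G)⁻¹, A.mul_mem p.2.2.1 (A.inv_mem (hBA p.1.2))⟩,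
        ⟨p.1, p.1.2, by simpa [mul_assoc] using p.2.2.2⟩⟩
      invFun := fun s => ⟨⟨s.2.1, s.2.2.1⟩, ⟨s.1 * s.2.1, A.mul_mem s.1.2 (hBA s.2.2.1),
        by simpa [mul_assoc] using s.2.2.2⟩⟩
      left_inv := fun p => by ext <;> simp
      right_inv := fun s => Sigma.subtype_ext (by ext; simp) rfl }
  have hfin (x : A) : Finite {y : G // y ∈ B ∧ y⁻¹ * ((x : G)⁻¹ * w * x) * y ∈ C} :=
    Finite.of_injective (fun y => (⟨y.1, y.2.1⟩ : B)) fun a b h => by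
      simpa [Subtype.ext_iff] using h
  rw [cosetCharacter, mul_div_assoc', ← Nat.cast_mul, ← Nat.card_prod, Nat.card_congr e,
    Nat.card_sigma, Nat.cast_sum, Finset.sum_div]
  refine Finset.sum_congr rfl fun x _ => ?_
  split_ifs with hx
  · rfl
  · rw [div_eq_zero_iff, Nat.cast_eq_zero, Nat.card_eq_zero]
    refine Or.inl (Or.inl ⟨fun y => hx ?_⟩)
    have := B.mul_mem (B.mul_mem y.2.1 (hCB y.2.2)) (B.inv_mem y.2.1)
    simpa [mul_assoc] using this

/-- If a class function `d` is a linear combination of characters `cosetCharacter B C`, then so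
is its product with `cosetCharacter A B`. -/
theorem sum_cosetCharacter {G ι : Type*} [Group G] {A B : Subgroup G} [Finite A] (hBA : B ≤ A)
    (s : Finset ι) (C : ι → Subgroup G) (hC : ∀ i ∈ s, C i ≤ B) (ε : ι → ℝ) (d : G → ℝ)
    (hd : ∀ x w, d (x⁻¹ * w * x) = d w)
    (h : ∀ w ∈ B, ∑ i ∈ s, ε i * cosetCharacter B (C i) w = d w) (w : G) :
    ∑ i ∈ s, ε i * cosetCharacter A (C i) w = d w * cosetCharacter A B w := by
  classical
  have := Fintype.ofFinite A
  have : Finite B := Finite.of_injective _ (Subgroup.inclusion_injective hBA)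
  have h4 : (Nat.card B : ℝ) ≠ 0 := by exact_mod_cast Nat.card_pos.ne'
  apply mul_left_cancel₀ h4
  -- After multiplication by |B|, both sides are sums over x ∈ A with x⁻¹wx ∈ B; on the right the
  -- inner character is that of `B` on `B ⧸ B`, which is 1.
  rw [mul_left_comm, card_mul_cosetCharacter hBA le_rfl, Finset.mul_sum, Finset.mul_sum]
  have h1 : ∀ i ∈ s, (Nat.card B : ℝ) * (ε i * cosetCharacter A (C i) w) =
      ∑ x : A, if (x : G)⁻¹ * w * x ∈ B then ε i * cosetCharacter B (C i) ((x : G)⁻¹ * w * x)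
        else 0 := by
    intro i hi
    rw [mul_left_comm, card_mul_cosetCharacter hBA (hC i hi), Finset.mul_sum]
    exact Finset.sum_congr rfl fun x _ => by split_ifs <;> simp
  rw [Finset.sum_congr rfl h1, Finset.sum_comm]
  refine Finset.sum_congr rfl fun x _ => ?_
  split_ifs with hx
  · rw [h _ hx, hd, cosetCharacter_self hx, mul_one]
  · simp

/-! ### Summation over decreasing sequences. -/

/-- If `∑_{K ⊆ I} (-1)^|K| P(K) = d P(I)` for all `I ⊆ S`, then the alternating sum of `P(Iₙ)` over
the weakly decreasing sequences `S = I₀ ⊇ ⋯ ⊇ Iₙ` is `dⁿ P(S)`. -/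
theorem sum_decreasing_sequences {α : Type*} [DecidableEq α]
    (P : Finset α → ℝ) (d : ℝ) (n : ℕ) (S : Finset α)
    (h : ∀ I ⊆ S, ∑ K ∈ I.powerset, (-1 : ℝ) ^ K.card * P K = d * P I)
    (X : Finset (Fin (n + 1) → Finset α)) (hX : ∀ I, I ∈ X ↔ I 0 = S ∧ Antitone I) :
    ∑ I ∈ X, (-1 : ℝ) ^ (∑ i : Fin n, (I i.succ).card) * P (I (Fin.last n)) = d ^ n * P S := by
  induction n generalizing S with
  | zero =>
    have : X = {fun _ => S} := by
      ext I
      rw [hX, Finset.mem_singleton]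
      constructor
      · rintro ⟨h0, -⟩
        ext1 i
        rw [Fin.fin_one_eq_zero i, h0]
      · rintro rfl
        exact ⟨rfl, fun _ _ _ => le_rfl⟩
    simp [this]
  | succ n ih =>
    have hmap : ∀ I ∈ X, I 1 ∈ S.powerset := fun I hI => by
      have h2 := (hX I).1 hI
      exact Finset.mem_powerset.2 (h2.1 ▸ h2.2 (Fin.zero_le 1))
    -- Group by I₁ = K. The tails are the sequences starting at K and contribute dⁿ P(K); the
    -- hypothesis at `S` supplies the last factor d.
    rw [← Finset.sum_fiberwise_of_maps_to hmap, pow_succ, mul_assoc, ← h S Finset.Subset.rfl,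
      Finset.mul_sum]
    refine Finset.sum_congr rfl fun K hK => ?_
    rw [Finset.mem_powerset] at hK
    have ih' := ih K (fun I hI => h I (hI.trans hK)) ((X.filter fun I => I 1 = K).image Fin.tail)
      (by
        intro I
        simp only [Finset.mem_image, Finset.mem_filter, hX]
        constructor
        · rintro ⟨J, ⟨⟨-, hJ⟩, h1⟩, rfl⟩
          exact ⟨h1, fun i j hij => hJ (Fin.succ_le_succ_iff.2 hij)⟩
        · rintro ⟨h0, hI⟩
          refine ⟨Fin.cons S I, ⟨⟨rfl, ?_⟩, h0⟩, Fin.tail_cons _ _⟩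
          intro i j hij
          induction i using Fin.cases with
          | zero =>
            induction j using Fin.cases with
            | zero => exact le_rfl
            | succ j =>
              simp only [Fin.cons_zero, Fin.cons_succ]
              exact (hI (Fin.zero_le j)).trans (h0.le.trans hK)
          | succ i =>
            induction j using Fin.cases with
            | zero => simp at hij
            | succ j =>
              simp only [Fin.cons_succ]
              exact hI (Fin.succ_le_succ_iff.1 hij))
    rw [mul_left_comm, ← ih', Finset.mul_sum, Finset.sum_image]
    · refine Finset.sum_congr rfl fun I hI => ?_
      rw [← mul_assoc, ← pow_add, Fin.sum_univ_succ, Fin.succ_zero_eq_one,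
        (Finset.mem_filter.1 hI).2]
      rfl
    · intro I hI J hJ hIJ
      have h1 := ((hX I).1 (Finset.mem_filter.1 hI).1).1
      have h2 := ((hX J).1 (Finset.mem_filter.1 hJ).1).1
      rw [← Fin.cons_self_tail I, ← Fin.cons_self_tail J, h1, h2, hIJ]

/-! ### The Euler relation for central arrangements. -/

/-- Strict signs persist under small moves, so a cell is open in its linear span. -/
theorem exists_sign_eq_of_apply_ne_zero {E : Type*} [AddCommGroup E] [Module ℝ E] {n : ℕ}
    (f : Fin n → Module.Dual ℝ E) {x v : E} (hv : ∀ i, f i x = 0 → f i v = 0) :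
    ∃ ε : ℝ, 0 < ε ∧ ∀ i, SignType.sign (f i (x + ε • v)) = SignType.sign (f i x) := by
  have key : ∀ i, ∀ᶠ ε in nhdsWithin (0 : ℝ) (Set.Ioi 0),
      SignType.sign (f i (x + ε • v)) = SignType.sign (f i x) := by
    intro i
    by_cases h : f i x = 0
    · filter_upwards with ε
      simp [h, hv i h]
    · have hc : Filter.Tendsto (fun ε : ℝ => f i (x + ε • v)) (nhds 0) (nhds (f i x)) := by
        have : Continuous fun ε : ℝ => f i x + ε * f i v := by fun_prop
        simpa using this.tendsto 0
      apply nhdsWithin_le_nhds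
      rcases lt_or_gt_of_ne h with h | h
      · filter_upwards [hc.eventually_lt_const h] with ε hε
        rw [sign_neg h, sign_neg hε]
      · filter_upwards [hc.eventually_const_lt h] with ε hε
        rw [sign_pos h, sign_pos hε]
  obtain ⟨ε, h1, h2⟩ := ((Filter.eventually_all.2 key).and self_mem_nhdsWithin).exists
  exact ⟨ε, h2, h1⟩

theorem exists_sign_eq_and_apply_eq_zero {E : Type*} [AddCommGroup E] [Module ℝ E] {n : ℕ}
    (f : Fin n → Module.Dual ℝ E) (g : Module.Dual ℝ E) {σ : Fin n → SignType} {x y : E}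
    (hx : ∀ i, SignType.sign (f i x) = σ i) (hy : ∀ i, SignType.sign (f i y) = σ i)
    (hgx : 0 < g x) (hgy : g y < 0) :
    ∃ z, (∀ i, SignType.sign (f i z) = σ i) ∧ g z = 0 := by
  -- Both coefficients are positive, and cells are convex cones.
  refine ⟨-g y • x + g x • y, fun i => ?_, by simp; ring⟩
  have h1 := hx i
  have h2 := hy i
  rw [← h1]
  rw [← h1] at h2
  simp only [map_add, map_smul, smul_eq_mul]
  rcases lt_trichotomy (f i x) 0 with h | h | h
  · rw [sign_neg h] at h2 ⊢
    rw [sign_eq_neg_one_iff] at h2 ⊢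
    nlinarith
  · rw [h, sign_zero] at h2 ⊢
    rw [sign_eq_zero_iff] at h2 ⊢
    simp [h2]
  · rw [sign_pos h] at h2 ⊢
    rw [sign_eq_one_iff] at h2 ⊢
    nlinarith

theorem finrank_inf_ker_add_one {E : Type*} [AddCommGroup E] [Module ℝ E] [FiniteDimensional ℝ E]
    (p : Submodule ℝ E) (g : Module.Dual ℝ E) {v : E} (hv : v ∈ p) (hg : g v ≠ 0) :
    Module.finrank ℝ (LinearMap.ker g ⊓ p : Submodule ℝ E) + 1 = Module.finrank ℝ p := by
  have h0 : g.domRestrict p ≠ 0 := fun h => hg (by simpa using LinearMap.congr_fun h ⟨v, hv⟩)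
  have h1 := Module.Dual.finrank_ker_add_one_of_ne_zero (f := g.domRestrict p) h0
  rw [← h1, LinearMap.ker_domRestrict]
  congr 1
  refine (LinearEquiv.finrank_eq ?_).symm
  exact (Submodule.equivSubtypeMap p _).trans (LinearEquiv.ofEq _ _ (by
    rw [Submodule.map_comap_subtype, inf_comm]))

-- Here `p` is the span of a cell of dimension d. If the hyperplane g = 0 cuts the cell properly,
-- the pieces have dimensions d - 1, d, d, and -(-1)^d + 2(-1)^d = (-1)^d. Otherwise the sign of g
-- is constant on the cell and one piece of the same dimension survives.
open Classical in
theorem sum_sign_cons {E : Type*} [AddCommGroup E] [Module ℝ E] [FiniteDimensional ℝ E] {n : ℕ}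
    (f : Fin n → Module.Dual ℝ E) (g : Module.Dual ℝ E) (σ : Fin n → SignType) :
    ∑ s : SignType, (if ∃ x, SignType.sign (g x) = s ∧ ∀ i, SignType.sign (f i x) = σ i then
        (-1 : ℝ) ^ Module.finrank ℝ ((⨅ _ : s = 0, LinearMap.ker g) ⊓
          ⨅ i, ⨅ _ : σ i = 0, LinearMap.ker (f i) : Submodule ℝ E) else 0) =
      if ∃ x, ∀ i, SignType.sign (f i x) = σ i then
        (-1 : ℝ) ^ Module.finrank ℝ (⨅ i, ⨅ _ : σ i = 0, LinearMap.ker (f i) : Submodule ℝ E)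
      else 0 := by
  set p : Submodule ℝ E := ⨅ i, ⨅ _ : σ i = 0, LinearMap.ker (f i) with hp
  have hmem : ∀ v, v ∈ p ↔ ∀ i, σ i = 0 → f i v = 0 := by
    intro v
    simp [hp, Submodule.mem_iInf]
  have huniv : (Finset.univ : Finset SignType) = {0, -1, 1} := rfl
  by_cases hex : ∃ x, ∀ i, SignType.sign (f i x) = σ i
  swap
  · rw [if_neg hex]
    refine Finset.sum_eq_zero fun s _ => if_neg ?_
    rintro ⟨x, -, hx⟩
    exact hex ⟨x, hx⟩
  rw [if_pos hex, huniv, Finset.sum_insert (by decide), Finset.sum_insert (by decide),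
    Finset.sum_singleton]
  have e0 : (⨅ _ : (0 : SignType) = 0, LinearMap.ker g) = LinearMap.ker g := iInf_pos rfl
  have e1 : (⨅ _ : (1 : SignType) = 0, LinearMap.ker g) = ⊤ := iInf_neg (by decide)
  have e2 : (⨅ _ : (-1 : SignType) = 0, LinearMap.ker g) = ⊤ := iInf_neg (by decide)
  rw [e0, e1, e2, top_inf_eq]
  simp only [sign_eq_zero_iff, sign_eq_neg_one_iff, sign_eq_one_iff]
  obtain ⟨x, hx⟩ := hex
  by_cases hg : ∃ v ∈ p, g v ≠ 0
  · obtain ⟨v, hvp, hgv⟩ := hg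
    wlog hpos : 0 < g v generalizing v
    · exact this (-v) (p.neg_mem hvp) (by simpa using hgv) (by
        rw [map_neg]
        exact neg_pos.2 (lt_of_le_of_ne (not_lt.1 hpos) hgv))
    have hmove : ∀ z, (∀ i, SignType.sign (f i z) = σ i) → ∀ u ∈ p, ∃ ε : ℝ, 0 < ε ∧
        ∀ i, SignType.sign (f i (z + ε • u)) = σ i := by
      intro z hz u hu
      obtain ⟨ε, h1, h2⟩ := exists_sign_eq_of_apply_ne_zero f (x := z) (v := u) (fun i hi =>
        (hmem u).1 hu i (by rw [← hz, hi, sign_zero]))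
      exact ⟨ε, h1, fun i => (h2 i).trans (hz i)⟩
    by_cases h0 : ∃ z, g z = 0 ∧ ∀ i, SignType.sign (f i z) = σ i
    · obtain ⟨z, hgz, hz⟩ := h0
      obtain ⟨ε, hε, h1⟩ := hmove z hz v hvp
      obtain ⟨δ, hδ, h2⟩ := hmove z hz (-v) (p.neg_mem hvp)
      have h1' : 0 < g (z + ε • v) := by
        rw [map_add, map_smul, hgz, zero_add]
        exact mul_pos hε hpos
      have h2' : g (z + δ • -v) < 0 := by
        rw [map_add, map_smul, hgz, zero_add, map_neg, smul_neg]
        exact neg_neg_of_pos (mul_pos hδ hpos)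
      rw [if_pos ⟨z, hgz, hz⟩, if_pos ⟨_, h2', h2⟩, if_pos ⟨_, h1', h1⟩,
        ← finrank_inf_ker_add_one p g hvp hgv]
      ring
    · rw [if_neg h0, zero_add]
      by_cases h1 : ∃ z, g z < 0 ∧ ∀ i, SignType.sign (f i z) = σ i
      · have h2 : ¬∃ z, 0 < g z ∧ ∀ i, SignType.sign (f i z) = σ i := by
          rintro ⟨y, hgy, hy⟩
          obtain ⟨z, hgz, hz⟩ := h1
          obtain ⟨t, ht, hgt⟩ := exists_sign_eq_and_apply_eq_zero f g hy hz hgy hgz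
          exact h0 ⟨t, hgt, ht⟩
        rw [if_pos h1, if_neg h2, add_zero]
      · have h2 : ∃ z, 0 < g z ∧ ∀ i, SignType.sign (f i z) = σ i := by
          rcases lt_trichotomy (g x) 0 with h | h | h
          · exact absurd ⟨x, h, hx⟩ h1
          · exact absurd ⟨x, h, hx⟩ h0
          · exact ⟨x, h, hx⟩
        rw [if_neg h1, if_pos h2, zero_add]
  -- Two points of the cell differ by an element of `p`, on which `g` vanishes, so only one sign
  -- occurs.
  · push Not at hg
    have hker : LinearMap.ker g ⊓ p = p := inf_eq_right.2 fun v hv => hg v hv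
    have huniq : ∀ z, (∀ i, SignType.sign (f i z) = σ i) → g z = g x := by
      intro z hz
      rw [← sub_eq_zero, ← map_sub]
      refine hg _ ((hmem _).2 fun i hi => ?_)
      have h1 := (hz i).trans hi
      have h2 := (hx i).trans hi
      rw [sign_eq_zero_iff] at h1 h2
      rw [map_sub, h1, h2, sub_zero]
    have hiff : ∀ P : ℝ → Prop,
        (∃ z, P (g z) ∧ ∀ i, SignType.sign (f i z) = σ i) ↔ P (g x) := fun P =>
      ⟨fun ⟨z, h1, h2⟩ => huniq z h2 ▸ h1, fun h => ⟨x, h, hx⟩⟩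
    rw [hker]
    simp only [hiff (· = 0), hiff (· < 0), hiff (0 < ·)]
    rcases lt_trichotomy (g x) 0 with h | h | h
    · simp [h, h.ne, h.le]
    · simp [h]
    · simp [h, h.ne', h.le]

open Classical in
/-- The Euler relation for the cells of a central hyperplane arrangement. -/
theorem sum_cells_neg_one_pow_finrank {E : Type*} [AddCommGroup E] [Module ℝ E]
    [FiniteDimensional ℝ E] {n : ℕ} (f : Fin n → Module.Dual ℝ E) :
    ∑ σ : Fin n → SignType, (if ∃ x, ∀ i, SignType.sign (f i x) = σ i then
        (-1 : ℝ) ^ Module.finrank ℝ (⨅ i, ⨅ _ : σ i = 0, LinearMap.ker (f i) : Submodule ℝ E)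
      else 0) = (-1) ^ Module.finrank ℝ E := by
  induction n with
  | zero =>
    rw [Fintype.sum_unique, if_pos ⟨0, fun i => i.elim0⟩, iInf_of_empty, finrank_top]
  | succ n ih =>
    rw [← ih (Fin.tail f), ← (Fin.consEquiv fun _ => SignType).sum_comp, Fintype.sum_prod_type,
      Finset.sum_comm]
    refine Finset.sum_congr rfl fun σ _ => ?_
    rw [← sum_sign_cons (Fin.tail f) (f 0) σ]
    refine Finset.sum_congr rfl fun s _ => ?_
    simp only [Fin.consEquiv_apply, Fin.forall_fin_succ, Fin.cons_zero, Fin.cons_succ, Fin.tail]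
    refine if_congr Iff.rfl ?_ rfl
    congr 1
    refine congrArg (fun p : Submodule ℝ E => Module.finrank ℝ p) (Submodule.ext fun v => ?_)
    simp [Submodule.mem_iInf, Fin.forall_fin_succ]

/-! ### Determinants of orthogonal maps. -/

/-- An orthogonal map without nonzero fixed vectors has determinant `(-1)^dim`. -/
theorem det_eq_neg_one_pow_of_fixed_eq_bot {E : Type*} [NormedAddCommGroup E]
    [InnerProductSpace ℝ E] [FiniteDimensional ℝ E] (φ : E ≃ₗᵢ[ℝ] E)
    (h : ∀ v, φ v = v → v = 0) :
    LinearMap.det (φ.toLinearEquiv : E →ₗ[ℝ] E) = (-1) ^ Module.finrank ℝ E := by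
  set A : E →ₗ[ℝ] E := (φ.toLinearEquiv : E →ₗ[ℝ] E) with hA
  set B : E →ₗ[ℝ] E := (φ.symm.toLinearEquiv : E →ₗ[ℝ] E) with hB
  have hadj : LinearMap.adjoint A = B := by
    symm
    rw [LinearMap.eq_adjoint_iff]
    intro x y
    have := φ.inner_map_map (φ.symm x) y
    rw [φ.apply_symm_apply] at this
    exact this.symm
  have h1 : LinearMap.det (A - 1) ≠ 0 := by
    intro h0
    refine (LinearMap.bot_lt_ker_of_det_eq_zero h0).ne' ((Submodule.eq_bot_iff _).2 fun v hv => ?_)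
    exact h v (sub_eq_zero.1 hv)
  -- Since B = A⁻¹ is the adjoint of A, B - 1 and A - 1 have the same determinant; as it is nonzero,
  -- it cancels from the determinants of this identity.
  have h2 : A - 1 = -(A * (B - 1)) := by
    ext v
    simp [hA, hB]
  have h3 : LinearMap.det (B - 1) = LinearMap.det (A - 1) := by
    rw [← hadj]
    have h0 : LinearMap.adjoint A - 1 = LinearMap.adjoint (A - 1) := by
      rw [map_sub, LinearMap.adjoint_one]
    rw [h0, ← LinearMap.det_toMatrix (stdOrthonormalBasis ℝ E).toBasis, LinearMap.toMatrix_adjoint,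
      Matrix.det_conjTranspose, LinearMap.det_toMatrix, star_trivial]
  have h4 : LinearMap.det (A - 1) = (-1) ^ Module.finrank ℝ E * (LinearMap.det A *
      LinearMap.det (A - 1)) := by
    conv_lhs => rw [h2, ← neg_one_smul ℝ, LinearMap.det_smul, map_mul, h3]
  have h5 : 1 = (-1) ^ Module.finrank ℝ E * LinearMap.det A := by
    apply mul_right_cancel₀ h1
    rw [one_mul, mul_assoc, ← h4]
  have h6 : ((-1 : ℝ) ^ Module.finrank ℝ E) * (-1) ^ Module.finrank ℝ E = 1 := by
    rw [← mul_pow]; simp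
  calc LinearMap.det A = ((-1) ^ Module.finrank ℝ E * (-1) ^ Module.finrank ℝ E) *
      LinearMap.det A := by rw [h6, one_mul]
    _ = _ := by rw [mul_assoc, ← h5, mul_one]

/-- The determinant of an orthogonal map is `(-1)^k` with `k` the codimension of the subspace
of fixed vectors. -/
theorem det_eq_neg_one_pow {E : Type*} [NormedAddCommGroup E]
    [InnerProductSpace ℝ E] [FiniteDimensional ℝ E] (φ : E ≃ₗᵢ[ℝ] E) (U : Submodule ℝ E)
    (hU : ∀ v, v ∈ U ↔ φ v = v) :
    LinearMap.det (φ.toLinearEquiv : E →ₗ[ℝ] E) =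
      (-1) ^ (Module.finrank ℝ E + Module.finrank ℝ U) := by
  have hmaps : ∀ v ∈ Uᗮ, φ v ∈ Uᗮ := by
    intro v hv u hu
    rw [← (hU u).1 hu, φ.inner_map_map]
    exact hv u hu
  let ψ : Uᗮ ≃ₗᵢ[ℝ] Uᗮ := LinearIsometry.toLinearIsometryEquiv
    { toLinearMap := (φ.toLinearEquiv : E →ₗ[ℝ] E).restrict hmaps
      norm_map' := fun v => φ.norm_map v } rfl
  -- φ has no nonzero fixed vector in Uᗮ and acts trivially on `E ⧸ Uᗮ`, since φv - v is orthogonal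
  -- to U. The exponent dim E + dim U has the parity of dim Uᗮ.
  have h1 := LinearMap.det_eq_det_mul_det Uᗮ (φ.toLinearEquiv : E →ₗ[ℝ] E) hmaps
  have h2 : Uᗮ.mapQ Uᗮ (φ.toLinearEquiv : E →ₗ[ℝ] E) hmaps = LinearMap.id := by
    refine Submodule.linearMap_qext _ (LinearMap.ext fun v => ?_)
    simp only [LinearMap.comp_apply, Submodule.mkQ_apply, Submodule.mapQ_apply, LinearMap.id_apply]
    rw [Submodule.Quotient.eq]
    intro u hu
    rw [inner_sub_right, sub_eq_zero]
    conv_lhs => rw [← (hU u).1 hu]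
    exact φ.inner_map_map u v
  have h3 := det_eq_neg_one_pow_of_fixed_eq_bot ψ (by
    intro v hv
    have hvU : (v : E) ∈ U := (hU v).2 (congrArg Subtype.val hv)
    ext
    exact inner_self_eq_zero.1 (v.2 v hvU))
  have h4 : (ψ.toLinearEquiv : Uᗮ →ₗ[ℝ] Uᗮ) =
      (φ.toLinearEquiv : E →ₗ[ℝ] E).restrict hmaps := by
    ext v
    rfl
  rw [h1, h2, LinearMap.det_id, mul_one, ← h4, h3, ← U.finrank_add_finrank_orthogonal,
    add_right_comm, ← two_mul, pow_add, pow_mul]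
  simp

/-! ### Reflections and the finiteness of W. -/

section Reflection

variable {V : Type*} [NormedAddCommGroup V] [InnerProductSpace ℝ V]

/-- The extremality arguments need only the sign of the coefficient. -/
theorem rootReflection_apply_eq_sub (α v : V) :
    ∃ c : ℝ, rootReflection α v = v - (c * inner ℝ v α) • α ∧ 0 ≤ c ∧ (α ≠ 0 → 0 < c) := by
  refine ⟨2 / inner ℝ α α, by rw [rootReflection_apply, inner_smul_right], ?_, fun h => ?_⟩
  · exact div_nonneg (by norm_num) real_inner_self_nonneg
  · exact div_pos (by norm_num) (real_inner_self_pos.2 h)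

theorem inner_rootReflection (α x y : V) :
    inner ℝ (rootReflection α x) (rootReflection α y) = inner ℝ x y :=
  (Submodule.reflection (Submodule.span ℝ {α})ᗮ).inner_map_map x y

theorem rootReflection_self (α : V) : rootReflection α α = -α :=
  Submodule.reflection_orthogonalComplement_singleton_eq_neg α

theorem rootReflection_eq_self {α v : V} (h : inner ℝ v α = 0) : rootReflection α v = v := by
  rw [rootReflection_apply, inner_smul_right, h, mul_zero, zero_smul, sub_zero]

theorem rootReflection_rootReflection (α v : V) : rootReflection α (rootReflection α v) = v :=
  Submodule.reflection_reflection _ v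

theorem rootReflection_mul_self (α : V) : rootReflection α * rootReflection α = 1 :=
  LinearEquiv.ext (rootReflection_rootReflection α)

theorem rootReflection_neg (α : V) : rootReflection (-α) = rootReflection α := by
  ext v
  simp [rootReflection_apply]

theorem rootReflection_conj {g : V ≃ₗ[ℝ] V} (hg : ∀ x y, inner ℝ (g x) (g y) = inner ℝ x y)
    (α : V) : g * rootReflection α * g⁻¹ = rootReflection (g α) := by
  ext v
  obtain ⟨u, rfl⟩ := g.surjective v
  have : (g * rootReflection α * g⁻¹) (g u) = g (rootReflection α u) := by
    change g (rootReflection α (g.symm (g u))) = _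
    rw [g.symm_apply_apply]
  rw [this, rootReflection_apply, rootReflection_apply, map_sub, map_smul, inner_smul_right,
    inner_smul_right, hg, hg]

theorem inner_map_map_of_mem_closure {s : Set V} {g : V ≃ₗ[ℝ] V}
    (hg : g ∈ Subgroup.closure (rootReflection '' s)) (x y : V) :
    inner ℝ (g x) (g y) = inner ℝ x y := by
  induction hg using Subgroup.closure_induction generalizing x y with
  | mem _ h =>
    obtain ⟨α, -, rfl⟩ := h
    exact inner_rootReflection α x y
  | one => rfl
  | mul a b _ _ ha hb => exact (ha _ _).trans (hb _ _)
  | inv a _ ha =>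
    rw [← ha]
    exact congrArg₂ _ (a.apply_symm_apply x) (a.apply_symm_apply y)

theorem inner_inv_apply {s : Set V} {g : V ≃ₗ[ℝ] V}
    (hg : g ∈ Subgroup.closure (rootReflection '' s)) (x y : V) :
    inner ℝ (g⁻¹ x) y = inner ℝ x (g y) := by
  rw [← inner_map_map_of_mem_closure hg (g⁻¹ x) y]
  exact congrArg (inner ℝ · _) (g.apply_symm_apply x)

theorem exists_list_of_mem_closure {s : Set V} {g : V ≃ₗ[ℝ] V}
    (hg : g ∈ Subgroup.closure (rootReflection '' s)) :
    ∃ L : List V, (∀ α ∈ L, α ∈ s) ∧ (L.map rootReflection).prod = g := by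
  induction hg using Subgroup.closure_induction with
  | mem _ h =>
    obtain ⟨α, hα, rfl⟩ := h
    exact ⟨[α], by simpa using hα, by simp⟩
  | one => exact ⟨[], by simp, rfl⟩
  | mul a b _ _ ha hb =>
    obtain ⟨L, hL, rfl⟩ := ha
    obtain ⟨M, hM, rfl⟩ := hb
    exact ⟨L ++ M, fun α h => (List.mem_append.1 h).elim (hL α) (hM α), by simp⟩
  | inv a _ ha =>
    obtain ⟨L, hL, rfl⟩ := ha
    refine ⟨L.reverse, fun α h => hL α (List.mem_reverse.1 h), ?_⟩
    rw [List.prod_inv_reverse, List.map_map, List.map_reverse]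
    congr 2

theorem map_eq_self_of_mem_closure {s : Set V} {g : V ≃ₗ[ℝ] V}
    (hg : g ∈ Subgroup.closure (rootReflection '' s)) {v : V} (hv : ∀ α ∈ s, inner ℝ v α = 0) :
    g v = v := by
  induction hg using Subgroup.closure_induction with
  | mem _ h =>
    obtain ⟨α, hα, rfl⟩ := h
    exact rootReflection_eq_self (hv α hα)
  | one => rfl
  | mul a b _ _ ha hb => exact (congrArg a hb).trans ha
  | inv a _ ha => exact a.symm_apply_eq.2 ha.symm

theorem IsRootSystem.map_mem {Φ : Finset V} (hΦ : IsRootSystem Φ) {g : V ≃ₗ[ℝ] V}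
    (hg : g ∈ reflectionGroup Φ) {β : V} (hβ : β ∈ Φ) : g β ∈ Φ := by
  obtain ⟨L, hL, rfl⟩ := exists_list_of_mem_closure hg
  induction L with
  | nil => simpa using hβ
  | cons α L ih =>
    rw [List.map_cons, List.prod_cons]
    have hL' : ∀ α ∈ L, α ∈ (Φ : Set V) := fun γ h => hL γ (List.mem_cons_of_mem _ h)
    refine hΦ.reflection_mem α (hL α List.mem_cons_self) _ (ih hL' ?_)
    exact Subgroup.list_prod_mem _ fun x hx => by
      obtain ⟨γ, hγ, rfl⟩ := List.mem_map.1 hx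
      exact Subgroup.subset_closure ⟨γ, hL' γ hγ, rfl⟩

theorem IsRootSystem.ne_zero {Φ : Finset V} (hΦ : IsRootSystem Φ) {β : V} (hβ : β ∈ Φ) : β ≠ 0 :=
  fun h => hΦ.zero_notMem (h ▸ hβ)

theorem IsRootSystem.neg_mem {Φ : Finset V} (hΦ : IsRootSystem Φ) {β : V} (hβ : β ∈ Φ) :
    -β ∈ Φ :=
  rootReflection_self β ▸ hΦ.reflection_mem β hβ β hβ

/-- W fixes the orthogonal complement of Φ pointwise, so its elements are determined by their action
on Φ. -/
theorem IsRootSystem.finite_reflectionGroup [FiniteDimensional ℝ V] {Φ : Finset V}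
    (hΦ : IsRootSystem Φ) : Finite (reflectionGroup Φ) := by
  refine Finite.of_injective
    (fun (g : reflectionGroup Φ) (β : Φ) => (⟨(g : V ≃ₗ[ℝ] V) β, hΦ.map_mem g.2 β.2⟩ : Φ)) ?_
  intro g h hgh
  have hΦgh : ∀ β ∈ Φ, (g : V ≃ₗ[ℝ] V) β = (h : V ≃ₗ[ℝ] V) β := fun β hβ =>
    congrArg Subtype.val (congrFun hgh ⟨β, hβ⟩)
  ext v
  obtain ⟨a, ha, b, hb, rfl⟩ := (Submodule.span ℝ (Φ : Set V)).exists_add_mem_mem_orthogonal v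
  have h1 : (g : V ≃ₗ[ℝ] V) a = (h : V ≃ₗ[ℝ] V) a :=
    LinearMap.eqOn_span (f := ((g : V ≃ₗ[ℝ] V) : V →ₗ[ℝ] V))
      (g := ((h : V ≃ₗ[ℝ] V) : V →ₗ[ℝ] V)) (fun β hβ => hΦgh β hβ) ha
  have hb' : ∀ α ∈ (Φ : Set V), inner ℝ b α = 0 := fun α hα => by
    rw [real_inner_comm]
    exact hb α (Submodule.subset_span hα)
  rw [map_add, map_add, h1, map_eq_self_of_mem_closure g.2 hb',
    map_eq_self_of_mem_closure h.2 hb']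

end Reflection

/-! ### Nonnegative combinations and dual points. -/

section Cone

variable {V : Type*} [NormedAddCommGroup V] [InnerProductSpace ℝ V]

theorem inner_nonneg_of_mem_span {s : Set V} {x β : V} (hx : ∀ δ ∈ s, 0 ≤ inner ℝ x δ)
    (hβ : β ∈ Submodule.span ℝ≥0 s) : 0 ≤ inner ℝ x β := by
  induction hβ using Submodule.span_induction with
  | mem δ h => exact hx δ h
  | zero => simp
  | add a b _ _ ha hb =>
    rw [inner_add_right]
    exact add_nonneg ha hb
  | smul c a _ ha =>
    rw [NNReal.smul_def, inner_smul_right]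
    exact mul_nonneg c.2 ha

/-- A sum of nonnegative terms vanishes only termwise, so β involves only those δ that are
orthogonal to x. -/
theorem mem_span_of_inner_eq_zero {s : Finset V} {x β : V} (hx : ∀ δ ∈ s, 0 ≤ inner ℝ x δ)
    (hβ : β ∈ Submodule.span ℝ≥0 (s : Set V)) (h : inner ℝ x β = 0) :
    β ∈ Submodule.span ℝ≥0 {δ | δ ∈ s ∧ inner ℝ x δ = 0} := by
  obtain ⟨c, -, rfl⟩ := Submodule.mem_span_finset.1 hβ
  rw [inner_sum] at h
  simp only [NNReal.smul_def, inner_smul_right] at h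
  replace h := (Finset.sum_eq_zero_iff_of_nonneg fun δ hδ => mul_nonneg (c δ).2 (hx δ hδ)).1 h
  refine Submodule.sum_mem _ fun δ hδ => ?_
  rcases mul_eq_zero.1 (h δ hδ) with h0 | h0
  · rw [NNReal.coe_eq_zero.1 h0, zero_smul]
    exact Submodule.zero_mem _
  · exact Submodule.smul_mem _ _ (Submodule.subset_span ⟨hδ, h0⟩)

theorem span_nnreal_le_span_real (s : Set V) {β : V} (h : β ∈ Submodule.span ℝ≥0 s) :
    β ∈ Submodule.span ℝ s :=
  Submodule.span_le_restrictScalars ℝ≥0 ℝ s h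

theorem exists_inner_eq [FiniteDimensional ℝ V] {s : Set V} (hs : LinearIndepOn ℝ id s)
    (f : V → ℝ) : ∃ x : V, ∀ δ ∈ s, inner ℝ x δ = f δ := by
  let b := Module.Basis.extend hs
  let φ : V →ₗ[ℝ] ℝ := b.constr ℝ fun i => f i
  refine ⟨(InnerProductSpace.toDual ℝ V).symm (LinearMap.toContinuousLinearMap φ), fun δ hδ => ?_⟩
  rw [InnerProductSpace.toDual_symm_apply]
  have h1 : b ⟨δ, hs.subset_extend _ hδ⟩ = δ := Module.Basis.extend_apply_self hs _
  have h2 := b.constr_basis ℝ (fun i => f i) ⟨δ, hs.subset_extend _ hδ⟩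
  rw [h1] at h2
  exact h2

end Cone

/-! ### Exchange condition, fundamental chamber, parabolic subsystems. -/

section SimpleSystem

variable {V : Type*} [NormedAddCommGroup V] [InnerProductSpace ℝ V] {Φ Δ : Finset V}

theorem IsSimpleSystem.mem_or_neg_mem (hΔ : IsSimpleSystem Φ Δ) {β : V} (hβ : β ∈ Φ) :
    β ∈ Submodule.span ℝ≥0 (Δ : Set V) ∨ -β ∈ Submodule.span ℝ≥0 (Δ : Set V) := by
  have h : β ∈ (Φ : Set V) := hβ
  rw [hΔ.eq_union] at h
  exact h.imp (fun h => h.2) (fun h => h.2)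

theorem IsSimpleSystem.not_mem_and_neg_mem (hΦ : IsRootSystem Φ) (hΔ : IsSimpleSystem Φ Δ) {β : V}
    (hβ : β ∈ Φ) (h1 : β ∈ Submodule.span ℝ≥0 (Δ : Set V))
    (h2 : -β ∈ Submodule.span ℝ≥0 (Δ : Set V)) : False :=
  hΔ.disjoint.notMem_of_mem_left (show β ∈ positiveRoots Φ Δ from ⟨hβ, h1⟩) ⟨hΦ.neg_mem hβ, h2⟩

theorem IsSimpleSystem.closure_le (hΔ : IsSimpleSystem Φ Δ) :
    Subgroup.closure (rootReflection '' (Δ : Set V)) ≤ reflectionGroup Φ :=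
  Subgroup.closure_mono (Set.image_mono hΔ.subset)

/-- Take x orthogonal to α and pairing to 1 with the other simple roots. As s_α preserves the
pairing with x, ⟨x, β⟩ is both ≥ 0 and ≤ 0; hence β is a nonnegative multiple of α, and Φ is
reduced. -/
theorem IsSimpleSystem.eq_of_neg_reflection_mem [FiniteDimensional ℝ V] (hΦ : IsRootSystem Φ)
    (hΔ : IsSimpleSystem Φ Δ) {α β : V} (hα : α ∈ Δ) (hβ : β ∈ Φ)
    (h1 : β ∈ Submodule.span ℝ≥0 (Δ : Set V))
    (h2 : -(rootReflection α β) ∈ Submodule.span ℝ≥0 (Δ : Set V)) : β = α := by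
  classical
  obtain ⟨x, hx⟩ := exists_inner_eq hΔ.linearIndepOn fun δ => if δ = α then 0 else 1
  have hx0 : ∀ δ ∈ (Δ : Set V), 0 ≤ inner ℝ x δ := fun δ hδ => by
    rw [hx δ hδ]
    split_ifs <;> norm_num
  have h3 := inner_nonneg_of_mem_span hx0 h1
  have h4 := inner_nonneg_of_mem_span hx0 h2
  have hxα : inner ℝ x α = 0 := by simpa using hx α hα
  rw [rootReflection_apply, inner_neg_right, inner_sub_right, inner_smul_right, hxα, mul_zero,
    sub_zero] at h4
  have h5 := mem_span_of_inner_eq_zero hx0 h1 (le_antisymm (by linarith) h3)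
  have h6 : {δ | δ ∈ Δ ∧ inner ℝ x δ = 0} ⊆ ({α} : Set V) := by
    rintro δ ⟨hδ, h⟩
    by_contra hne
    replace hne : ¬δ = α := hne
    rw [hx δ hδ, if_neg hne] at h
    exact one_ne_zero h
  obtain ⟨c, rfl⟩ := Submodule.mem_span_singleton.1 (Submodule.span_mono h6 h5)
  rw [NNReal.smul_def] at hβ ⊢
  rcases hΦ.reduced α (hΔ.subset hα) c hβ with h | h
  · rw [h, one_smul]
  · exact absurd c.2 (by rw [NNReal.val_eq_coe, h]; norm_num)

theorem prod_map_rootReflection_mem {s : Set V} {L : List V} (hL : ∀ α ∈ L, α ∈ s) :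
    (L.map rootReflection).prod ∈ Subgroup.closure (rootReflection '' s) :=
  Subgroup.list_prod_mem _ fun x hx => by
    obtain ⟨γ, hγ, rfl⟩ := List.mem_map.1 hx
    exact Subgroup.subset_closure ⟨γ, hL γ hγ, rfl⟩

/-- The exchange condition. -/
theorem IsSimpleSystem.exchange [FiniteDimensional ℝ V] (hΦ : IsRootSystem Φ)
    (hΔ : IsSimpleSystem Φ Δ) {α : V} (hα : α ∈ Δ) (L : List V) (hL : ∀ γ ∈ L, γ ∈ Δ)
    (h : -((L.map rootReflection).prod α) ∈ Submodule.span ℝ≥0 (Δ : Set V)) :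
    ∃ M : List V, (∀ γ ∈ M, γ ∈ Δ) ∧ M.length + 1 = L.length ∧
      (L.map rootReflection).prod = (M.map rootReflection).prod * rootReflection α := by
  induction L with
  | nil =>
    exact (hΔ.not_mem_and_neg_mem hΦ (hΔ.subset hα) (Submodule.subset_span hα)
      (by simpa using h)).elim
  | cons γ L ih =>
    have hγ := hL γ List.mem_cons_self
    have hL' : ∀ δ ∈ L, δ ∈ Δ := fun δ hδ => hL δ (List.mem_cons_of_mem _ hδ)
    have hmem := prod_map_rootReflection_mem (s := (Δ : Set V)) hL'
    have hroot := hΦ.map_mem (hΔ.closure_le hmem) (hΔ.subset hα)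
    rw [List.map_cons, List.prod_cons] at h ⊢
    rcases hΔ.mem_or_neg_mem hroot with hp | hn
    -- With u the product over `L`, the root uα turns negative exactly at the letter γ, so uα = γ
    -- and s_γ u = u s_α.
    · have heq := hΔ.eq_of_neg_reflection_mem hΦ hγ hroot hp h
      refine ⟨L, hL', rfl, ?_⟩
      rw [← heq, ← rootReflection_conj (inner_map_map_of_mem_closure hmem)]
      group
    · obtain ⟨M, hM, hlen, hprod⟩ := ih hL' hn
      refine ⟨γ :: M, ?_, by simp [hlen], ?_⟩
      · intro δ hδ
        rcases List.mem_cons.1 hδ with rfl | hδ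
        exacts [hγ, hM δ hδ]
      · rw [hprod, List.map_cons, List.prod_cons, mul_assoc]

/-- Induction on word length. If g makes a simple α negative, then 0 ≤ ⟨gx, -gα⟩ = -⟨x, α⟩ forces
⟨x, α⟩ = 0, so s_α fixes x and the exchange condition splits it off. -/
theorem IsSimpleSystem.map_eq_self_of_list [FiniteDimensional ℝ V] (hΦ : IsRootSystem Φ)
    (hΔ : IsSimpleSystem Φ Δ) {x : V} (hx : ∀ δ ∈ Δ, 0 ≤ inner ℝ x δ) (n : ℕ) :
    ∀ L : List V, L.length = n → (∀ γ ∈ L, γ ∈ Δ) →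
      (∀ δ ∈ Δ, 0 ≤ inner ℝ ((L.map rootReflection).prod x) δ) →
      (L.map rootReflection).prod x = x ∧ (L.map rootReflection).prod ∈
        Subgroup.closure (rootReflection '' {δ | δ ∈ Δ ∧ inner ℝ x δ = 0}) := by
  induction n using Nat.strong_induction_on with
  | _ n ih =>
    intro L hlen hL hy
    have hmem := prod_map_rootReflection_mem (s := (Δ : Set V)) hL
    by_cases hex : ∃ α ∈ Δ, -((L.map rootReflection).prod α) ∈ Submodule.span ℝ≥0 (Δ : Set V)
    · obtain ⟨α, hα, hneg⟩ := hex
      obtain ⟨M, hM, hMlen, hprod⟩ := hΔ.exchange hΦ hα L hL hneg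
      have h1 := inner_nonneg_of_mem_span hy hneg
      rw [inner_neg_right, inner_map_map_of_mem_closure hmem] at h1
      have h0 : inner ℝ x α = 0 := le_antisymm (by linarith) (hx α hα)
      have hMx : (L.map rootReflection).prod x = (M.map rootReflection).prod x := by
        rw [hprod, LinearEquiv.mul_apply, rootReflection_eq_self h0]
      obtain ⟨h2, h3⟩ := ih M.length (by omega) M rfl hM (by rwa [hMx] at hy)
      refine ⟨hMx.trans h2, ?_⟩
      rw [hprod]
      exact Subgroup.mul_mem _ h3 (Subgroup.subset_closure ⟨α, ⟨hα, h0⟩, rfl⟩)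
    -- If no simple root becomes negative, a nonempty word is not reduced: its last letter α is sent
    -- to a negative root by the rest `K`, and exchange cancels two letters.
    · rcases List.eq_nil_or_concat' L with rfl | ⟨K, α, rfl⟩
      · exact ⟨rfl, Subgroup.one_mem _⟩
      · have hα : α ∈ Δ := hL α (by simp)
        have hK : ∀ γ ∈ K, γ ∈ Δ := fun γ hγ => hL γ (List.mem_append_left _ hγ)
        have hroot := hΦ.map_mem (hΔ.closure_le hmem) (hΔ.subset hα)
        have hpos := (hΔ.mem_or_neg_mem hroot).resolve_right fun h => hex ⟨α, hα, h⟩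
        have hKα : ((K ++ [α]).map rootReflection).prod =
            (K.map rootReflection).prod * rootReflection α := by simp
        rw [hKα, LinearEquiv.mul_apply, rootReflection_self, map_neg] at hpos
        obtain ⟨M, hM, hMlen, hprod⟩ := hΔ.exchange hΦ hα K hK hpos
        have hML : ((K ++ [α]).map rootReflection).prod = (M.map rootReflection).prod := by
          rw [hKα, hprod, mul_assoc, rootReflection_mul_self, mul_one]
        rw [hML] at hy ⊢
        exact ih M.length (by simp at hlen; omega) M rfl hM hy

/-- The closed fundamental chamber meets each orbit at most once, and stabilizers of its points
are generated by simple reflections. -/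
theorem IsSimpleSystem.map_eq_self [FiniteDimensional ℝ V] (hΦ : IsRootSystem Φ)
    (hΔ : IsSimpleSystem Φ Δ) {x : V} (hx : ∀ δ ∈ Δ, 0 ≤ inner ℝ x δ) {g : V ≃ₗ[ℝ] V}
    (hg : g ∈ Subgroup.closure (rootReflection '' (Δ : Set V)))
    (hy : ∀ δ ∈ Δ, 0 ≤ inner ℝ (g x) δ) :
    g x = x ∧ g ∈ Subgroup.closure (rootReflection '' {δ | δ ∈ Δ ∧ inner ℝ x δ = 0}) := by
  obtain ⟨L, hL, rfl⟩ := exists_list_of_mem_closure hg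
  exact hΔ.map_eq_self_of_list hΦ hx L.length L rfl hL hy

theorem IsSimpleSystem.finite_closure [FiniteDimensional ℝ V] (hΦ : IsRootSystem Φ)
    (hΔ : IsSimpleSystem Φ Δ) :
    Finite (Subgroup.closure (rootReflection '' (Δ : Set V))) := by
  have := hΦ.finite_reflectionGroup
  exact Finite.of_injective _ (Subgroup.inclusion_injective hΔ.closure_le)

/-- Every orbit meets the closed fundamental chamber. -/
theorem IsSimpleSystem.exists_map_mem_chamber [FiniteDimensional ℝ V] (hΦ : IsRootSystem Φ)
    (hΔ : IsSimpleSystem Φ Δ) (x : V) :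
    ∃ g ∈ Subgroup.closure (rootReflection '' (Δ : Set V)), ∀ δ ∈ Δ, 0 ≤ inner ℝ (g x) δ := by
  obtain ⟨ρ, hρ⟩ := exists_inner_eq hΔ.linearIndepOn fun _ => 1
  have := hΔ.finite_closure hΦ
  -- If gx were on the negative side of a simple δ, reflecting it in δ would increase ⟨ρ, gx⟩.
  obtain ⟨g, hg⟩ := Finite.exists_max
    fun g : Subgroup.closure (rootReflection '' (Δ : Set V)) => inner ℝ ρ ((g : V ≃ₗ[ℝ] V) x)
  refine ⟨g, g.2, fun δ hδ => ?_⟩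
  have h := hg (⟨rootReflection δ, Subgroup.subset_closure ⟨δ, hδ, rfl⟩⟩ * g)
  obtain ⟨c, hc, -, hpos⟩ := rootReflection_apply_eq_sub δ ((g : V ≃ₗ[ℝ] V) x)
  change inner ℝ ρ (rootReflection δ ((g : V ≃ₗ[ℝ] V) x)) ≤ _ at h
  rw [hc, inner_sub_right, inner_smul_right, hρ δ hδ] at h
  have := hpos (hΦ.ne_zero (hΔ.subset hδ))
  by_contra hlt
  have := mul_pos_of_neg_of_neg (neg_neg_of_pos this) (not_le.1 hlt)
  linarith

theorem exists_inner_pos_of_mem_span {s : Set V} {γ : V} (hγ : γ ∈ Submodule.span ℝ≥0 s)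
    (h0 : γ ≠ 0) : ∃ δ ∈ s, 0 < inner ℝ γ δ := by
  by_contra hcon
  have h1 : 0 ≤ inner ℝ (-γ) γ := inner_nonneg_of_mem_span (fun δ hδ => by
    rw [inner_neg_left]
    exact neg_nonneg.2 (not_lt.1 fun h => hcon ⟨δ, hδ, h⟩)) hγ
  rw [inner_neg_left] at h1
  exact absurd (real_inner_self_pos.2 h0) (not_lt.2 (neg_nonneg.1 h1))

/-- Choose a positive root γ of least height ⟨ρ, γ⟩ in the orbit and a simple δ with ⟨γ, δ⟩ > 0. The
reflected root s_δ γ is lower, hence negative, which forces γ = δ. -/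
theorem IsSimpleSystem.exists_map_mem_of_mem_span [FiniteDimensional ℝ V] (hΦ : IsRootSystem Φ)
    (hΔ : IsSimpleSystem Φ Δ) {β : V} (hβ : β ∈ Φ) (hp : β ∈ Submodule.span ℝ≥0 (Δ : Set V)) :
    ∃ g ∈ Subgroup.closure (rootReflection '' (Δ : Set V)), g β ∈ Δ := by
  classical
  obtain ⟨ρ, hρ⟩ := exists_inner_eq hΔ.linearIndepOn fun _ => 1
  obtain ⟨T, hT⟩ : ∃ T : Finset V, ∀ γ, γ ∈ T ↔ γ ∈ Φ ∧ γ ∈ Submodule.span ℝ≥0 (Δ : Set V) ∧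
      ∃ g ∈ Subgroup.closure (rootReflection '' (Δ : Set V)), g β = γ :=
    ⟨Φ.filter _, fun γ => Finset.mem_filter⟩
  have hβT : β ∈ T := (hT β).2 ⟨hβ, hp, 1, Subgroup.one_mem _, rfl⟩
  obtain ⟨γ, hγ, hmin⟩ := Finset.exists_min_image T (fun γ => inner ℝ ρ γ) ⟨β, hβT⟩
  obtain ⟨hγΦ, hγp, g, hg, hgβ⟩ := (hT γ).1 hγ
  obtain ⟨δ, hδ, hpos⟩ := exists_inner_pos_of_mem_span hγp (hΦ.ne_zero hγΦ)
  refine ⟨g, hg, ?_⟩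
  rw [hgβ]
  have hroot := hΦ.reflection_mem δ (hΔ.subset hδ) _ hγΦ
  rcases hΔ.mem_or_neg_mem hroot with h | h
  · have hgen : rootReflection δ ∈ Subgroup.closure (rootReflection '' (Δ : Set V)) :=
      Subgroup.subset_closure ⟨δ, hδ, rfl⟩
    have h1 := hmin (rootReflection δ γ) ((hT _).2 ⟨hroot, h, rootReflection δ * g,
      Subgroup.mul_mem _ hgen hg, by rw [LinearEquiv.mul_apply, hgβ]⟩)
    obtain ⟨c, hc, -, hcpos⟩ := rootReflection_apply_eq_sub δ γ
    rw [hc, inner_sub_right, inner_smul_right, hρ δ hδ] at h1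
    have := mul_pos (hcpos (hΦ.ne_zero (hΔ.subset hδ))) hpos
    linarith
  · rw [hΔ.eq_of_neg_reflection_mem hΦ hδ hγΦ hγp h]
    exact hδ

/-- The reflection group is generated by the simple reflections. -/
theorem IsSimpleSystem.closure_eq [FiniteDimensional ℝ V] (hΦ : IsRootSystem Φ)
    (hΔ : IsSimpleSystem Φ Δ) :
    Subgroup.closure (rootReflection '' (Δ : Set V)) = reflectionGroup Φ := by
  refine le_antisymm hΔ.closure_le ((Subgroup.closure_le _).2 ?_)
  have key : ∀ β ∈ Φ, β ∈ Submodule.span ℝ≥0 (Δ : Set V) →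
      rootReflection β ∈ Subgroup.closure (rootReflection '' (Δ : Set V)) := by
    intro β hβ hp
    obtain ⟨g, hg, hgβ⟩ := hΔ.exists_map_mem_of_mem_span hΦ hβ hp
    have h1 := rootReflection_conj (inner_map_map_of_mem_closure hg) β
    have h2 : rootReflection β = g⁻¹ * rootReflection (g β) * g := by
      rw [← h1]
      group
    rw [h2]
    exact Subgroup.mul_mem _ (Subgroup.mul_mem _ (Subgroup.inv_mem _ hg)
      (Subgroup.subset_closure ⟨_, hgβ, rfl⟩)) hg
  rintro _ ⟨β, hβ, rfl⟩
  rcases hΔ.mem_or_neg_mem hβ with h | h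
  · exact key β hβ h
  · exact rootReflection_neg β ▸ key (-β) (hΦ.neg_mem hβ) h

theorem IsRootSystem.filter_mem_span [FiniteDimensional ℝ V] (hΦ : IsRootSystem Φ) (J : Set V)
    [DecidablePred (· ∈ Submodule.span ℝ J)] :
    IsRootSystem (Φ.filter (· ∈ Submodule.span ℝ J)) where
  zero_notMem h := hΦ.zero_notMem (Finset.mem_filter.1 h).1
  reflection_mem α hα β hβ := by
    obtain ⟨hα, hα'⟩ := Finset.mem_filter.1 hα
    obtain ⟨hβ, hβ'⟩ := Finset.mem_filter.1 hβ
    refine Finset.mem_filter.2 ⟨hΦ.reflection_mem α hα β hβ, ?_⟩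
    rw [rootReflection_apply]
    exact Submodule.sub_mem _ hβ' (Submodule.smul_mem _ _ hα')
  reduced α hα c hc := hΦ.reduced α (Finset.mem_filter.1 hα).1 c (Finset.mem_filter.1 hc).1

theorem IsSimpleSystem.mem_span_subset [FiniteDimensional ℝ V] (hΔ : IsSimpleSystem Φ Δ)
    {J : Finset V} (hJ : J ⊆ Δ) {β : V} (hβ : β ∈ Submodule.span ℝ≥0 (Δ : Set V))
    (h : β ∈ Submodule.span ℝ (J : Set V)) : β ∈ Submodule.span ℝ≥0 (J : Set V) := by
  classical
  obtain ⟨x, hx⟩ := exists_inner_eq hΔ.linearIndepOn fun δ => if δ ∈ J then 0 else 1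
  have hx0 : ∀ δ ∈ Δ, 0 ≤ inner ℝ x δ := fun δ hδ => by
    rw [hx δ hδ]
    split_ifs <;> norm_num
  have h0 : inner ℝ x β = 0 := by
    have hle : Submodule.span ℝ (J : Set V) ≤ LinearMap.ker (innerₛₗ ℝ x) :=
      Submodule.span_le.2 fun δ hδ => (hx δ (hJ hδ)).trans (if_pos hδ)
    exact hle h
  refine Submodule.span_mono ?_ (mem_span_of_inner_eq_zero hx0 hβ h0)
  rintro δ ⟨hδ, h⟩
  by_contra hne
  replace hne : ¬δ ∈ J := hne
  rw [hx δ hδ, if_neg hne] at h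
  exact one_ne_zero h

/-- This makes W_J a reflection group in its own right, to which Solomon's formula applies. -/
theorem IsSimpleSystem.filter_mem_span [FiniteDimensional ℝ V]
    (hΔ : IsSimpleSystem Φ Δ) {J : Finset V} (hJ : J ⊆ Δ)
    [DecidablePred (· ∈ Submodule.span ℝ (J : Set V))] :
    IsSimpleSystem (Φ.filter (· ∈ Submodule.span ℝ (J : Set V))) J where
  subset α hα := Finset.mem_filter.2 ⟨hΔ.subset (hJ hα), Submodule.subset_span hα⟩
  linearIndepOn := hΔ.linearIndepOn.mono hJ
  eq_union := by
    ext β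
    simp only [positiveRoots, Finset.coe_filter, Set.mem_union, Set.mem_inter_iff,
      Set.mem_ofPred_eq, SetLike.mem_coe, Set.mem_neg]
    constructor
    · rintro ⟨hβ, hβJ⟩
      have h : β ∈ (Φ : Set V) := hβ
      rw [hΔ.eq_union] at h
      rcases h with h | h
      · exact Or.inl ⟨⟨hβ, hβJ⟩, hΔ.mem_span_subset hJ h.2 hβJ⟩
      · have hn := Submodule.neg_mem _ hβJ
        exact Or.inr ⟨⟨h.1, hn⟩, hΔ.mem_span_subset hJ h.2 hn⟩
    · rintro (⟨h, -⟩ | ⟨⟨h1, h2⟩, h3⟩)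
      · exact h
      · refine ⟨?_, by simpa using h2⟩
        change β ∈ (Φ : Set V)
        rw [hΔ.eq_union]
        exact Or.inr ⟨h1, Submodule.span_mono hJ h3⟩
  disjoint := by
    have hsub : positiveRoots (Φ.filter (· ∈ Submodule.span ℝ (J : Set V))) J ⊆
        positiveRoots Φ Δ := fun β hβ =>
      ⟨(Finset.mem_filter.1 hβ.1).1, Submodule.span_mono hJ hβ.2⟩
    exact hΔ.disjoint.mono hsub (Set.neg_subset_neg.2 hsub)

end SimpleSystem

/-! ### Faces of the Coxeter complex and Solomon's formula. -/

section Solomon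

variable {V : Type*} [NormedAddCommGroup V] [InnerProductSpace ℝ V] {Φ Δ : Finset V}

/-- A face of the closed chamber lies in a single cell of the root arrangement. -/
theorem IsSimpleSystem.sign_inner_eq (hΔ : IsSimpleSystem Φ Δ) {x y : V}
    (hx : ∀ δ ∈ Δ, 0 ≤ inner ℝ x δ) (hy : ∀ δ ∈ Δ, 0 ≤ inner ℝ y δ)
    (hxy : ∀ δ ∈ Δ, inner ℝ x δ = 0 ↔ inner ℝ y δ = 0) {β : V} (hβ : β ∈ Φ) :
    SignType.sign (inner ℝ x β) = SignType.sign (inner ℝ y β) := by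
  have zero_of {x y : V} (hx : ∀ δ ∈ Δ, 0 ≤ inner ℝ x δ)
      (hxy : ∀ δ ∈ Δ, inner ℝ x δ = 0 → inner ℝ y δ = 0) {β : V}
      (hβ : β ∈ Submodule.span ℝ≥0 (Δ : Set V)) (h : inner ℝ x β = 0) : inner ℝ y β = 0 := by
    have hle : Submodule.span ℝ {δ | δ ∈ Δ ∧ inner ℝ x δ = 0} ≤ LinearMap.ker (innerₛₗ ℝ y) :=
      Submodule.span_le.2 fun δ hδ => hxy δ hδ.1 hδ.2
    exact hle (span_nnreal_le_span_real _ (mem_span_of_inner_eq_zero hx hβ h))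
  have key : ∀ β ∈ Submodule.span ℝ≥0 (Δ : Set V),
      SignType.sign (inner ℝ x β) = SignType.sign (inner ℝ y β) := by
    intro β hβ
    have h1 := inner_nonneg_of_mem_span hx hβ
    have h2 := inner_nonneg_of_mem_span hy hβ
    rcases h1.eq_or_lt with h | h
    · rw [← h, zero_of hx (fun δ hδ => (hxy δ hδ).1) hβ h.symm]
    · have h3 : inner ℝ y β ≠ 0 := fun h0 =>
        h.ne' (zero_of hy (fun δ hδ => (hxy δ hδ).2) hβ h0)
      rw [sign_pos h, sign_pos (lt_of_le_of_ne h2 h3.symm)]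
  rcases hΔ.mem_or_neg_mem hβ with h | h
  · exact key β h
  · have := key (-β) h
    rwa [inner_neg_right, inner_neg_right, Left.sign_neg, Left.sign_neg, neg_inj] at this

theorem nonneg_iff_of_sign_eq {a b : ℝ} (h : SignType.sign a = SignType.sign b) :
    0 ≤ a ↔ 0 ≤ b := by
  rw [← sign_nonneg_iff, h, sign_nonneg_iff]

theorem eq_zero_iff_of_sign_eq {a b : ℝ} (h : SignType.sign a = SignType.sign b) :
    a = 0 ↔ b = 0 := by
  rw [← sign_eq_zero_iff, h, sign_eq_zero_iff]

theorem IsSimpleSystem.finrank_orthogonal [FiniteDimensional ℝ V] (hΔ : IsSimpleSystem Φ Δ)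
    {K : Finset V} (hK : K ⊆ Δ) :
    K.card + Module.finrank ℝ (Submodule.span ℝ (K : Set V))ᗮ = Module.finrank ℝ V := by
  rw [← Submodule.finrank_add_finrank_orthogonal (Submodule.span ℝ (K : Set V))]
  congr 1
  have h := hΔ.linearIndepOn.mono (Finset.coe_subset.2 hK)
  exact (finrank_span_finset_eq_card h).symm

/-- The linear span of a face of the Coxeter complex that is fixed by `w`. -/
theorem IsSimpleSystem.mem_span_face_iff [FiniteDimensional ℝ V] (hΦ : IsRootSystem Φ)
    (hΔ : IsSimpleSystem Φ Δ) {K : Finset V} (hK : K ⊆ Δ) {x : V}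
    (hx : ∀ δ ∈ Δ, 0 ≤ inner ℝ x δ) (hxK : ∀ δ ∈ Δ, inner ℝ x δ = 0 ↔ δ ∈ K)
    {g w : V ≃ₗ[ℝ] V} (hg : g ∈ reflectionGroup Φ) (hw : g⁻¹ * w * g ∈ reflectionGroup K)
    (u : V) :
    (w (g u) = g u ∧ ∀ β ∈ Φ, inner ℝ (g x) β = 0 → inner ℝ (g u) β = 0) ↔
      u ∈ (Submodule.span ℝ (K : Set V))ᗮ := by
  have hginv {β : V} (v : V) : inner ℝ (g v) β = inner ℝ v (g⁻¹ β) := by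
    rw [real_inner_comm, ← inner_inv_apply hg, real_inner_comm]
  have hle : u ∈ (Submodule.span ℝ (K : Set V))ᗮ ↔ ∀ α ∈ K, inner ℝ u α = 0 := by
    constructor
    · intro h α hα
      rw [real_inner_comm]
      exact h α (Submodule.subset_span hα)
    · intro h v hv
      have hle : Submodule.span ℝ (K : Set V) ≤ LinearMap.ker (innerₛₗ ℝ u) :=
        Submodule.span_le.2 fun δ hδ => h δ hδ
      rw [real_inner_comm]
      exact hle hv
  rw [hle]
  constructor
  · rintro ⟨-, h⟩ α hα
    have h1 := h (g α) (hΦ.map_mem hg (hΔ.subset (hK hα)))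
    rw [inner_map_map_of_mem_closure hg, inner_map_map_of_mem_closure hg] at h1
    exact h1 ((hxK α (hK hα)).2 hα)
  · intro h
    constructor
    · have h1 := map_eq_self_of_mem_closure hw h
      have h2 : g ((g⁻¹ * w * g) u) = w (g u) := by
        rw [← LinearEquiv.mul_apply, ← LinearEquiv.mul_apply]
        congr 1
        group
      rw [← h2, h1]
    · intro β hβ hβ0
      rw [hginv] at hβ0 ⊢
      have hroot := hΦ.map_mem (inv_mem hg) hβ
      have key : ∀ γ ∈ Submodule.span ℝ≥0 (Δ : Set V), inner ℝ x γ = 0 → inner ℝ u γ = 0 := by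
        intro γ hγ h0
        have hle : Submodule.span ℝ {δ | δ ∈ Δ ∧ inner ℝ x δ = 0} ≤ LinearMap.ker (innerₛₗ ℝ u) :=
          Submodule.span_le.2 fun δ hδ => h δ ((hxK δ hδ.1).1 hδ.2)
        exact hle (span_nnreal_le_span_real _ (mem_span_of_inner_eq_zero hx hγ h0))
      rcases hΔ.mem_or_neg_mem hroot with h1 | h1
      · exact key _ h1 hβ0
      · have := key _ h1 (by rw [inner_neg_right, hβ0, neg_zero])
        rwa [inner_neg_right, neg_eq_zero] at this

/-- The span `M` of the cell, computed inside U, is all of g(K^⊥): the face is fixed pointwise, so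
restricting to U loses no dimension. -/
theorem IsSimpleSystem.finrank_face [FiniteDimensional ℝ V] (hΦ : IsRootSystem Φ)
    (hΔ : IsSimpleSystem Φ Δ) {K : Finset V} (hK : K ⊆ Δ) {x : V}
    (hx : ∀ δ ∈ Δ, 0 ≤ inner ℝ x δ) (hxK : ∀ δ ∈ Δ, inner ℝ x δ = 0 ↔ δ ∈ K)
    {g w : V ≃ₗ[ℝ] V} (hg : g ∈ reflectionGroup Φ) (hw : g⁻¹ * w * g ∈ reflectionGroup K)
    {U : Submodule ℝ V} (hU : ∀ v, v ∈ U ↔ w v = v) (M : Submodule ℝ U)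
    (hM : ∀ v : U, v ∈ M ↔ ∀ β ∈ Φ, inner ℝ (g x) β = 0 → inner ℝ (v : V) β = 0) :
    K.card + Module.finrank ℝ M = Module.finrank ℝ V := by
  have h1 : M.map U.subtype = ((Submodule.span ℝ (K : Set V))ᗮ).map (g : V →ₗ[ℝ] V) := by
    ext v
    obtain ⟨u, rfl⟩ := g.surjective v
    have h2 := hΔ.mem_span_face_iff hΦ hK hx hxK hg hw u
    have h3 : g u ∈ ((Submodule.span ℝ (K : Set V))ᗮ).map (g : V →ₗ[ℝ] V) ↔
        u ∈ (Submodule.span ℝ (K : Set V))ᗮ := by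
      constructor
      · rintro ⟨t, ht, htu⟩
        exact g.injective htu ▸ ht
      · exact fun h => ⟨u, h, rfl⟩
    rw [h3, ← h2]
    constructor
    · rintro ⟨t, ht, htu⟩
      rw [← htu]
      exact ⟨(hU t).1 t.2, (hM t).1 ht⟩
    · rintro ⟨h4, h5⟩
      exact ⟨⟨g u, (hU _).2 h4⟩, (hM _).2 h5, rfl⟩
  rw [← hΔ.finrank_orthogonal hK, ← Submodule.finrank_map_subtype_eq U M, h1,
    LinearEquiv.finrank_map_eq]

/-- Solomon's formula: the determinant is the alternating sum of the permutation characters on the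
cosets of the standard parabolic subgroups. -/
theorem IsSimpleSystem.sum_cosetCharacter_eq_det [FiniteDimensional ℝ V] (hΦ : IsRootSystem Φ)
    (hΔ : IsSimpleSystem Φ Δ) {w : V ≃ₗ[ℝ] V} (hw : w ∈ reflectionGroup Δ) :
    ∑ K ∈ Δ.powerset, (-1 : ℝ) ^ K.card *
        cosetCharacter (reflectionGroup Δ) (reflectionGroup K) w =
      LinearMap.det (w : V →ₗ[ℝ] V) := by
  classical
  have hGW : reflectionGroup Δ = reflectionGroup Φ := hΔ.closure_eq hΦ
  have := hΔ.finite_closure hΦ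
  have : Finite (reflectionGroup Δ) := this
  have := Fintype.ofFinite (reflectionGroup Δ)
  have hGK : ∀ K ⊆ Δ, reflectionGroup K ≤ reflectionGroup Δ := fun K hK =>
    Subgroup.closure_mono (Set.image_mono hK)
  -- `p K` will be a point in the relative interior of the face C_K.
  have hp : ∀ K : Finset V, ∃ x : V, ∀ δ ∈ (Δ : Set V), inner ℝ x δ = if δ ∈ K then 0 else 1 :=
    fun K => exists_inner_eq hΔ.linearIndepOn _
  choose p hp using hp
  have hpD : ∀ K, ∀ δ ∈ Δ, 0 ≤ inner ℝ (p K) δ := fun K δ hδ => by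
    rw [hp K δ hδ]
    split_ifs <;> norm_num
  have hpK : ∀ K, ∀ δ ∈ Δ, inner ℝ (p K) δ = 0 ↔ δ ∈ K := fun K δ hδ => by
    rw [hp K δ hδ]
    split_ifs with h <;> simp [h]
  have hfix : ∀ K ⊆ Δ, ∀ k ∈ reflectionGroup K, k (p K) = p K := fun K hK k hk =>
    map_eq_self_of_mem_closure hk fun α hα => (hpK K α (hK hα)).2 hα
  have hstab : ∀ x : V, ∀ K ⊆ Δ, (∀ δ ∈ Δ, 0 ≤ inner ℝ x δ) →
      (∀ δ ∈ Δ, inner ℝ x δ = 0 ↔ δ ∈ K) → ∀ k ∈ reflectionGroup Δ,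
      (∀ δ ∈ Δ, 0 ≤ inner ℝ (k x) δ) → k x = x ∧ k ∈ reflectionGroup K := by
    intro x K hK hx hxK k hk hkx
    obtain ⟨h1, h2⟩ := hΔ.map_eq_self hΦ hx hk hkx
    refine ⟨h1, Subgroup.closure_mono (Set.image_mono ?_) h2⟩
    exact fun δ hδ => (hxK δ hδ.1).1 hδ.2
  let U : Submodule ℝ V := LinearMap.eqLocus (w : V →ₗ[ℝ] V) LinearMap.id
  have hU : ∀ v, v ∈ U ↔ w v = v := fun v => Iff.rfl
  let e := Φ.equivFin.symm
  let f : Fin Φ.card → Module.Dual ℝ U := fun i => (innerₛₗ ℝ (e i : V)).domRestrict U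
  have hf : ∀ i (u : U), f i u = inner ℝ (u : V) (e i) := fun i u => real_inner_comm _ _
  have hdet : LinearMap.det (w : V →ₗ[ℝ] V) = (-1) ^ (Module.finrank ℝ V + Module.finrank ℝ U) :=
    det_eq_neg_one_pow (w.isometryOfInner (inner_map_map_of_mem_closure hw)) U hU
  rw [hdet, pow_add, ← sum_cells_neg_one_pow_finrank f, ← Finset.sum_filter, Finset.mul_sum]
  have hcount : ∀ K ∈ Δ.powerset, (-1 : ℝ) ^ K.card *
        cosetCharacter (reflectionGroup Δ) (reflectionGroup K) w =
      ∑ q : reflectionGroup Δ ⧸ (reflectionGroup K).subgroupOf (reflectionGroup Δ) with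
        (⟨w, hw⟩ : reflectionGroup Δ) • q = q, (-1 : ℝ) ^ K.card := by
    intro K hK
    have := card_fixedBy_eq_cosetCharacter _ _ (hGK K (Finset.mem_powerset.1 hK)) ⟨w, hw⟩
    rw [← this, Finset.sum_const, nsmul_eq_mul, mul_comm, Nat.card_eq_fintype_card,
      Fintype.card_subtype]
    rfl
  rw [Finset.sum_congr rfl hcount, Finset.sum_sigma']
  have hfixed : ∀ K (g : reflectionGroup Δ),
      (⟨w, hw⟩ : reflectionGroup Δ) •
        (g : reflectionGroup Δ ⧸ (reflectionGroup K).subgroupOf (reflectionGroup Δ)) = g ↔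
      (g : V ≃ₗ[ℝ] V)⁻¹ * w * g ∈ reflectionGroup K := by
    intro K g
    rw [MulAction.Quotient.smul_coe, eq_comm, QuotientGroup.eq, Subgroup.mem_subgroupOf]
    simp [mul_assoc]
  let sg : V → Fin Φ.card → SignType := fun v i => SignType.sign (inner ℝ v (e i : V))
  have hsg : ∀ {u v : V}, sg u = sg v → ∀ β ∈ Φ,
      SignType.sign (inner ℝ u β) = SignType.sign (inner ℝ v β) := by
    intro u v h β hβ
    simpa [sg] using congrFun h (e.symm ⟨β, hβ⟩)
  have hinv : ∀ k ∈ reflectionGroup Δ, ∀ (v : V) (β : V),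
      inner ℝ (k v) β = inner ℝ v (k⁻¹ β) := fun k hk v β => by
    rw [real_inner_comm, ← inner_inv_apply hk, real_inner_comm]
  have hsgmap : ∀ {u v : V}, ∀ k ∈ reflectionGroup Δ, (∀ β ∈ Φ,
      SignType.sign (inner ℝ u β) = SignType.sign (inner ℝ v β)) → ∀ β ∈ Φ,
      SignType.sign (inner ℝ (k u) β) = SignType.sign (inner ℝ (k v) β) := by
    intro u v k hk h β hβ
    rw [hinv k hk, hinv k hk]
    exact h _ (hΦ.map_mem (inv_mem (hGW ▸ hk)) hβ)
  have hfixp : ∀ K ⊆ Δ, ∀ g : reflectionGroup Δ,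
      (g : V ≃ₗ[ℝ] V)⁻¹ * w * g ∈ reflectionGroup K →
      w ((g : V ≃ₗ[ℝ] V) (p K)) = (g : V ≃ₗ[ℝ] V) (p K) := by
    intro K hK g hg
    conv_rhs => rw [← hfix K hK _ hg]
    rw [← LinearEquiv.mul_apply, ← LinearEquiv.mul_apply]
    congr 1
    group
  -- The fixed coset gW_K goes to the sign vector of g(p K), that is, to the cell gC_K.
  refine Finset.sum_bij (fun a _ => sg ((a.2.out : V ≃ₗ[ℝ] V) (p a.1))) ?_ ?_ ?_ ?_
  · rintro ⟨K, q⟩ h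
    obtain ⟨hK, hq⟩ := Finset.mem_sigma.1 h
    replace hq := (Finset.mem_filter.1 hq).2
    rw [← QuotientGroup.out_eq' q, hfixed] at hq
    refine Finset.mem_filter.2 ⟨Finset.mem_univ _,
      ⟨_, (hU _).2 (hfixp K (Finset.mem_powerset.1 hK) _ hq)⟩, fun i => ?_⟩
    rw [hf]
  · rintro ⟨K, q⟩ h ⟨L, r⟩ h' heq
    have hK := Finset.mem_powerset.1 (Finset.mem_sigma.1 h).1
    have hL := Finset.mem_powerset.1 (Finset.mem_sigma.1 h').1
    replace heq := hsg heq
    have hk : (r.out⁻¹ * q.out : V ≃ₗ[ℝ] V) ∈ reflectionGroup Δ :=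
      mul_mem (inv_mem r.out.2) q.out.2
    have h1 := hsgmap _ (inv_mem r.out.2) heq
    have h2 : ∀ β ∈ Φ, SignType.sign (inner ℝ ((r.out⁻¹ * q.out : V ≃ₗ[ℝ] V) (p K)) β) =
        SignType.sign (inner ℝ (p L) β) := by
      intro β hβ
      refine (h1 β hβ).trans ?_
      rw [← LinearEquiv.mul_apply, inv_mul_cancel]
      rfl
    -- Equal cells put r⁻¹q(p K) in the closed chamber, so it equals `p K`, and r⁻¹q lies in W_K.
    obtain ⟨h3, h4⟩ := hstab (p K) K hK (hpD K) (hpK K) _ hk fun δ hδ =>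
      (nonneg_iff_of_sign_eq (h2 δ (hΔ.subset hδ))).2 (hpD L δ hδ)
    rw [h3] at h2
    have hKL : K = L := by
      ext δ
      constructor
      · intro hδ
        exact (hpK L δ (hK hδ)).1 ((eq_zero_iff_of_sign_eq (h2 δ (hΔ.subset (hK hδ)))).1
          ((hpK K δ (hK hδ)).2 hδ))
      · intro hδ
        exact (hpK K δ (hL hδ)).1 ((eq_zero_iff_of_sign_eq (h2 δ (hΔ.subset (hL hδ)))).2
          ((hpK L δ (hL hδ)).2 hδ))
    subst hKL
    have hqr : r = q := by
      rw [← QuotientGroup.out_eq' q, ← QuotientGroup.out_eq' r, QuotientGroup.eq,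
        Subgroup.mem_subgroupOf]
      exact h4
    rw [hqr]
  · intro σ hσ
    obtain ⟨u, hu⟩ := (Finset.mem_filter.1 hσ).2
    -- Surjectivity: move a point u of the cell into the chamber; K consists of the simple roots
    -- vanishing at gu, and the coset is that of g⁻¹.
    obtain ⟨g, hg, hgD⟩ := hΔ.exists_map_mem_chamber hΦ (u : V)
    let K := Δ.filter fun δ => inner ℝ (g u) δ = 0
    have hK : K ⊆ Δ := Finset.filter_subset _ _
    have hKmem : ∀ δ ∈ Δ, inner ℝ (g u) δ = 0 ↔ δ ∈ K := fun δ hδ => by simp [K, hδ]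
    let g' : reflectionGroup Δ := ⟨g, hg⟩⁻¹
    let q : reflectionGroup Δ ⧸ (reflectionGroup K).subgroupOf (reflectionGroup Δ) := g'
    have hgu : ∀ v, g⁻¹ (g v) = v := fun v => g.symm_apply_apply v
    have hwg : g * w * g⁻¹ ∈ reflectionGroup K := by
      refine (hstab (g u) K hK hgD hKmem _ (mul_mem (mul_mem hg hw) (inv_mem hg)) ?_).2
      have : (g * w * g⁻¹) (g u) = g u := by
        rw [LinearEquiv.mul_apply, LinearEquiv.mul_apply, hgu, (hU _).1 u.2]
      rwa [this]
    refine ⟨⟨K, q⟩, Finset.mem_sigma.2 ⟨Finset.mem_powerset.2 hK, Finset.mem_filter.2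
      ⟨Finset.mem_univ _, (hfixed K g').2 (by simpa [g'] using hwg)⟩⟩, ?_⟩
    obtain ⟨k, hk⟩ := QuotientGroup.mk_out_eq_mul
      ((reflectionGroup K).subgroupOf (reflectionGroup Δ)) g'
    have hqp : (q.out : V ≃ₗ[ℝ] V) (p K) = g⁻¹ (p K) := by
      have : (q.out : V ≃ₗ[ℝ] V) = g⁻¹ * ((k : reflectionGroup Δ) : V ≃ₗ[ℝ] V) :=
        congrArg Subtype.val hk
      rw [this, LinearEquiv.mul_apply]
      exact congrArg _ (hfix K hK _ k.2)
    ext1 i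
    rw [← hu i, hf]
    simp only [sg]
    rw [hqp]
    have h1 := hsgmap (u := p K) (v := g u) g⁻¹ (inv_mem hg) (fun β hβ =>
      hΔ.sign_inner_eq (hpD K) hgD (fun δ hδ => (hpK K δ hδ).trans (hKmem δ hδ).symm) hβ)
      (e i) (e i).2
    rwa [hgu] at h1
  · rintro ⟨K, q⟩ h
    obtain ⟨hK, hq⟩ := Finset.mem_sigma.1 h
    replace hq := (Finset.mem_filter.1 hq).2
    rw [← QuotientGroup.out_eq' q, hfixed] at hq
    have h1 := hΔ.finrank_face hΦ (Finset.mem_powerset.1 hK) (hpD K) (hpK K)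
      (hGW ▸ q.out.2) hq hU
      (⨅ i, ⨅ _ : sg ((q.out : V ≃ₗ[ℝ] V) (p K)) i = 0, LinearMap.ker (f i)) (by
        intro v
        simp only [Submodule.mem_iInf, LinearMap.mem_ker, hf, sg, sign_eq_zero_iff]
        constructor
        · intro h β hβ
          simpa using h (e.symm ⟨β, hβ⟩)
        · exact fun h i => h _ (e i).2)
    rw [← h1, pow_add, mul_assoc, ← pow_add, ← two_mul, pow_mul]
    simp

end Solomon

/-! ### From sets of simple roots to sets of simple reflections. -/

section Parabolic

variable {V : Type*} [NormedAddCommGroup V] [InnerProductSpace ℝ V] {Φ Δ : Finset V}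

/-- Solomon's formula for a standard parabolic subgroup, induced to the whole group. -/
theorem IsSimpleSystem.sum_cosetCharacter_eq_det_mul [FiniteDimensional ℝ V]
    (hΦ : IsRootSystem Φ) (hΔ : IsSimpleSystem Φ Δ) {J : Finset V} (hJ : J ⊆ Δ)
    (w : V ≃ₗ[ℝ] V) :
    ∑ K ∈ J.powerset, (-1 : ℝ) ^ K.card *
        cosetCharacter (reflectionGroup Φ) (reflectionGroup K) w =
      LinearMap.det (w : V →ₗ[ℝ] V) *
        cosetCharacter (reflectionGroup Φ) (reflectionGroup J) w := by
  classical
  have := hΦ.finite_reflectionGroup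
  refine sum_cosetCharacter (A := reflectionGroup Φ) (B := reflectionGroup J)
    (Subgroup.closure_mono (Set.image_mono (hJ.trans hΔ.subset)))
    J.powerset (fun K => reflectionGroup K)
    (fun K hK => Subgroup.closure_mono (Set.image_mono (Finset.mem_powerset.1 hK)))
    (fun K => (-1 : ℝ) ^ K.card) (fun w => LinearMap.det (w : V →ₗ[ℝ] V)) (fun x w => ?_)
    (fun w hw => (hΔ.filter_mem_span hJ).sum_cosetCharacter_eq_det (hΦ.filter_mem_span _) hw) w
  exact LinearMap.det_conj (w : V →ₗ[ℝ] V) x⁻¹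

/-- Ensures that |K| is the same for roots and for reflections, so that the signs agree. -/
theorem IsSimpleSystem.rootReflection_injOn [FiniteDimensional ℝ V]
    (hΦ : IsRootSystem Φ) (hΔ : IsSimpleSystem Φ Δ) :
    Set.InjOn rootReflection (Δ : Set V) := by
  intro α hα β hβ h
  refine hΔ.eq_of_neg_reflection_mem hΦ hβ (hΔ.subset hα) (Submodule.subset_span hα) ?_
  rw [← h, rootReflection_self, neg_neg]
  exact Submodule.subset_span hα

theorem inducedTrivialCharacter_parabolic (hΦ : IsRootSystem Φ) [FiniteDimensional ℝ V]
    {I : Finset (reflectionGroup Φ)} {J : Finset V}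
    (hIJ : Subtype.val '' (I : Set (reflectionGroup Φ)) = rootReflection '' (J : Set V))
    (w : reflectionGroup Φ) :
    inducedTrivialCharacter (parabolic I) w =
      cosetCharacter (reflectionGroup Φ) (reflectionGroup J) w := by
  have := hΦ.finite_reflectionGroup
  rw [inducedTrivialCharacter_eq_cosetCharacter, parabolic, MonoidHom.map_closure,
    Subgroup.coe_subtype, hIJ]
  rfl

theorem IsSimpleSystem.sum_inducedTrivialCharacter [FiniteDimensional ℝ V]
    (hΦ : IsRootSystem Φ) (hΔ : IsSimpleSystem Φ Δ) {I : Finset (reflectionGroup Φ)}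
    (hI : I ⊆ simpleReflections Φ Δ) (w : reflectionGroup Φ) :
    ∑ K ∈ I.powerset, (-1 : ℝ) ^ K.card * inducedTrivialCharacter (parabolic K) w =
      LinearMap.det ((w : V ≃ₗ[ℝ] V) : V →ₗ[ℝ] V) * inducedTrivialCharacter (parabolic I) w := by
  classical
  let roots : Finset (reflectionGroup Φ) → Finset V := fun K =>
    Δ.filter fun α => ∃ s ∈ K, rootReflection α = (s : V ≃ₗ[ℝ] V)
  have himage : ∀ K ⊆ simpleReflections Φ Δ,
      (K.image Subtype.val : Finset (V ≃ₗ[ℝ] V)) = (roots K).image rootReflection := by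
    intro K hK
    ext s
    simp only [Finset.mem_image, roots, Finset.mem_filter]
    constructor
    · rintro ⟨s, hs, rfl⟩
      obtain ⟨α, hα, h⟩ := mem_simpleReflections.1 (hK hs)
      exact ⟨α, ⟨hα, s, hs, h⟩, h⟩
    · rintro ⟨α, ⟨hα, s, hs, h⟩, rfl⟩
      exact ⟨s, hs, h.symm⟩
  have hroots : ∀ K, roots K ⊆ Δ := fun K => Finset.filter_subset _ _
  have hcard : ∀ K ⊆ simpleReflections Φ Δ, (roots K).card = K.card := fun K hK => by
    rw [← Finset.card_image_of_injOn ((hΔ.rootReflection_injOn hΦ).mono (hroots K)), ← himage K hK,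
      Finset.card_image_of_injective _ Subtype.val_injective]
  have hchar : ∀ K ⊆ simpleReflections Φ Δ, inducedTrivialCharacter (parabolic K) w =
      cosetCharacter (reflectionGroup Φ) (reflectionGroup (roots K)) w := fun K hK =>
    inducedTrivialCharacter_parabolic hΦ (by
      rw [← Finset.coe_image, ← Finset.coe_image, himage K hK]) w
  rw [hchar I hI, ← hΔ.sum_cosetCharacter_eq_det_mul hΦ (hroots I)]
  refine Finset.sum_bij (fun K _ => roots K) ?_ ?_ ?_ ?_
  · intro K hK
    rw [Finset.mem_powerset] at hK ⊢
    exact Finset.monotone_filter_right _ fun α _ ⟨s, hs, h⟩ => ⟨s, hK hs, h⟩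
  · intro K hK L hL h
    rw [Finset.mem_powerset] at hK hL
    refine Finset.image_injective Subtype.val_injective ?_
    rw [himage K (hK.trans hI), himage L (hL.trans hI), h]
  · intro J hJ
    rw [Finset.mem_powerset] at hJ
    refine ⟨I.filter fun s => ∃ α ∈ J, rootReflection α = (s : V ≃ₗ[ℝ] V),
      Finset.mem_powerset.2 (Finset.filter_subset _ _), ?_⟩
    ext α
    simp only [roots, Finset.mem_filter]
    constructor
    · rintro ⟨hα, s, ⟨hs, β, hβ, hβs⟩, hαs⟩
      rwa [hΔ.rootReflection_injOn hΦ hα (hroots I (hJ hβ)) (hαs.trans hβs.symm)]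
    · intro hα
      obtain ⟨hαΔ, s, hs, h⟩ := Finset.mem_filter.1 (hJ hα)
      exact ⟨hαΔ, s, ⟨hs, α, hα, h⟩, h⟩
  · intro K hK
    have hK' := (Finset.mem_powerset.1 hK).trans hI
    rw [hchar K hK', hcard K hK']

theorem IsSimpleSystem.inducedTrivialCharacter_parabolic_simpleReflections
    [FiniteDimensional ℝ V] (hΦ : IsRootSystem Φ) (hΔ : IsSimpleSystem Φ Δ)
    (w : reflectionGroup Φ) :
    inducedTrivialCharacter (parabolic (simpleReflections Φ Δ)) w = 1 := by
  have h : Subtype.val '' (simpleReflections Φ Δ : Set (reflectionGroup Φ)) =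
      rootReflection '' (Δ : Set V) := by
    ext s
    constructor
    · rintro ⟨s, hs, rfl⟩
      exact mem_simpleReflections.1 hs
    · rintro ⟨α, hα, rfl⟩
      exact ⟨⟨rootReflection α, Subgroup.subset_closure ⟨α, hΔ.subset hα, rfl⟩⟩,
        mem_simpleReflections.2 ⟨α, hα, rfl⟩, rfl⟩
  have := hΦ.finite_reflectionGroup
  have hG : reflectionGroup Δ = reflectionGroup Φ := hΔ.closure_eq hΦ
  rw [inducedTrivialCharacter_parabolic hΦ h, hG, cosetCharacter_self w.2]

end Parabolic

theorem det_compLeft {V : Type*} [AddCommGroup V] [Module ℝ V] [FiniteDimensional ℝ V] (n : ℕ)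
    (f : V →ₗ[ℝ] V) : LinearMap.det (f.compLeft (Fin n)) = LinearMap.det f ^ n := by
  have h : f.compLeft (Fin n) = LinearMap.pi fun i => f ∘ₗ LinearMap.proj i := rfl
  rw [h, LinearMap.det_pi, Finset.prod_const, Finset.card_univ, Fintype.card_fin]

end

end EuclideanRoots

theorem mainTheorem6 {V : Type*} [NormedAddCommGroup V] [InnerProductSpace ℝ V]
    [FiniteDimensional ℝ V] (Φ Δ : Finset V)
    (hΦ : EuclideanRoots.IsRootSystem Φ) (hΔ : EuclideanRoots.IsSimpleSystem Φ Δ)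
    (n : ℕ) (w : EuclideanRoots.reflectionGroup Φ) :
    LinearMap.det (((w : V ≃ₗ[ℝ] V) : V →ₗ[ℝ] V).compLeft (Fin n)) =
        LinearMap.det ((w : V ≃ₗ[ℝ] V) : V →ₗ[ℝ] V) ^ n ∧
      LinearMap.det ((w : V ≃ₗ[ℝ] V) : V →ₗ[ℝ] V) ^ n =
        ∑ I ∈ EuclideanRoots.chains Φ Δ n,
          (-1 : ℝ) ^ (∑ i : Fin n, (I i.succ).card) *
            EuclideanRoots.inducedTrivialCharacter
              (EuclideanRoots.parabolic (I (Fin.last n))) w := by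
  classical
  refine ⟨EuclideanRoots.det_compLeft n _, ?_⟩
  rw [EuclideanRoots.sum_decreasing_sequences
    (fun I => EuclideanRoots.inducedTrivialCharacter (EuclideanRoots.parabolic I) w)
    (LinearMap.det ((w : V ≃ₗ[ℝ] V) : V →ₗ[ℝ] V)) n (EuclideanRoots.simpleReflections Φ Δ)
    (fun I hI => hΔ.sum_inducedTrivialCharacter hΦ hI w) _
    (fun I => EuclideanRoots.mem_chains),
    hΔ.inducedTrivialCharacter_parabolic_simpleReflections hΦ w, mul_one]
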